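/- Let $D\subset\mathbb R^d$ ($d=1,2,3$) be open, bounded and connected (and non-empty), and let $X=L^2(D;\mathbb R)$. For $\nu,\ell,\sigma>0$ the Matérn operator $\mathcal C(\nu,\ell,\sigma):X\to X$ is $$(\mathcal C(\nu,\ell,\sigma)\varphi)(y)=\int_D \varphi(x)\,c(|x-y|)\,dx,\qquad c(z)=\frac{\sigma^2 2^{1-\nu}}{\Gamma(\nu)}\Big(\frac{\sqrt{2\nu}\,z}{\ell}\Big)^{\nu}K_\nu\Big(\frac{\sqrt{2\nu}\,z}{\ell}\Big),$$ where $K_\nu$ is the modified Bessel function of the second kind. Let $\mathrm{CO}(X)$ be the set of continuous linear operators on $X$ that are self-adjoint, positive semidefinite and trace class. For every $\nu\in(0,\infty)\setminus\mathbb N$ there is a constant $\mathrm{const}(\nu)>0$, depending only on $\nu$, such that the following holds for all such $d$ and $D$, every $\underline\ell>0$ and every even integer $N_{\mathrm{lin}}\ge 2$. Put $\zeta_{\max}=\mathrm{diam}(D)/\underline\ell$. There is a family $\widetilde{\mathcal C}_0(\nu,\ell,\sigma,N_{\mathrm{lin}})$, $\ell\ge\underline\ell$, $\sigma>0$, of operators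 in $\mathrm{CO}(X)$ which is linearly separable with $N_{\mathrm{lin}}$ terms, i.e. $$\widetilde{\mathcal C}_0(\nu,\ell,\sigma,N_{\mathrm{lin}})=\sum_{k=1}^{N_{\mathrm{lin}}}F_k(\ell,\sigma)\,\mathcal C_k$$ with real functions $F_k$ and continuous linear operators $\mathcal C_k$ on $X$ that depend neither on $\ell$ nor on $\sigma$, and for all $\ell\ge\underline\ell$ and $\sigma>0$, in the operator norm, $$\big\|\widetilde{\mathcal C}_0(\nu,\ell,\sigma,N_{\mathrm{lin}})-\mathcal C(\nu,\ell,\sigma)\big\|\le \mathrm{const}(\nu)\,\sigma^2\,\mathrm{Leb}(D)\,\big(1+\zeta_{\max}^{2\nu}\big)\exp\Big(\frac{\zeta_{\max}^2}{4}\Big)\frac{(\sqrt{2\nu}\,\zeta_{\max})^{N_{\mathrm{lin}}}}{N_{\mathrm{lin}}!}.$$ In particular, if $\zeta_{\max}\ge\sqrt{2\nu}$, then $$\big\|\widetilde{\mathcal C}_0(\nu,\ell,\sigma,N_{\mathrm{lin}})-\mathcal C(\nu,\ell,\sigma)\big\|\le \mathrm{const}(\nu)\,\sigma^2\,\mathrm{Leb}(D)\,\big(1+\zeta_{\max}^{2\nu}\big)\exp\Big(\frac{\zeta_{\max}^2}{4}\Big)\frac{\zeta_{\max}^{2N_{\mathrm{lin}}}}{N_{\mathrm{lin}}!}.$$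 -/

import Mathlib

open MeasureTheory Set Filter Topology

noncomputable section

/-- The modified Bessel function of the second kind `K_ν(x)`, for real order `ν` and `x > 0`,
through its integral representation `K_ν(x) = ∫_0^∞ exp(-x cosh t) cosh(ν t) dt`. -/
def besselK (ν x : ℝ) : ℝ :=
  ∫ t in Ioi (0 : ℝ), Real.exp (-x * Real.cosh t) * Real.cosh (ν * t)

/-- The Matérn covariance function
`c(ν,ℓ,σ)(z) = σ² 2^(1-ν) / Γ(ν) * (√(2ν) z/ℓ)^ν * K_ν(√(2ν) z/ℓ)`, extended continuously
to `z = 0`, where its value is `σ²`. -/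
def maternKernel (ν ℓ σ z : ℝ) : ℝ :=
  if z = 0 then σ ^ 2
  else σ ^ 2 * (2 : ℝ) ^ (1 - ν) / Real.Gamma ν * (√(2 * ν) * z / ℓ) ^ ν
    * besselK ν (√(2 * ν) * z / ℓ)

/-- The real Hilbert space `L²(D; ℝ)` over a set `D ⊆ ℝ^d`, with Lebesgue measure. -/
abbrev L2 {d : ℕ} (D : Set (EuclideanSpace ℝ (Fin d))) : Type :=
  Lp ℝ 2 (volume.restrict D)

/-- `T` is the integral operator `φ ↦ ∫_D φ(x) k(x, ·) dx` on `L²(D)`. -/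
def HasKernel {d : ℕ} {D : Set (EuclideanSpace ℝ (Fin d))} (T : L2 D →L[ℝ] L2 D)
    (k : EuclideanSpace ℝ (Fin d) → EuclideanSpace ℝ (Fin d) → ℝ) : Prop :=
  ∀ φ : L2 D, T φ =ᵐ[volume.restrict D] fun y => ∫ x in D, φ x * k x y

open Classical in
/-- The bounded operator on `L²(D)` with kernel `k` (and `0` if there is none). -/
def integralOperator {d : ℕ} (D : Set (EuclideanSpace ℝ (Fin d)))
    (k : EuclideanSpace ℝ (Fin d) → EuclideanSpace ℝ (Fin d) → ℝ) : L2 D →L[ℝ] L2 D :=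
  if h : ∃ T : L2 D →L[ℝ] L2 D, HasKernel T k then h.choose else 0

/-- The Matérn-type covariance operator
`C(ν,ℓ,σ) φ = ∫_D φ(x) c(ν,ℓ,σ)(dist(x, ·)) dx` on `L²(D)`. That it really is given by this
integral on bounded `D` is `maternOperator_hasKernel` below. -/
def maternOperator {d : ℕ} (D : Set (EuclideanSpace ℝ (Fin d))) (ν ℓ σ : ℝ) :
    L2 D →L[ℝ] L2 D :=
  integralOperator D fun x y => maternKernel ν ℓ σ (dist x y)

/-- Trace-class operators on a Hilbert space, by nuclear representations:
`T = ∑ ⟪a n, ·⟫ b n` with `∑ ‖a n‖ ‖b n‖ < ∞`. -/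
def IsTraceClass {H : Type*} [NormedAddCommGroup H] [InnerProductSpace ℝ H]
    (T : H →L[ℝ] H) : Prop :=
  ∃ a b : ℕ → H, Summable (fun n => ‖a n‖ * ‖b n‖) ∧
    ∀ x : H, HasSum (fun n => (inner ℝ (a n) x : ℝ) • b n) (T x)

/-- The set `CO(H)` of valid covariance operators: linear, continuous, self-adjoint, positive
semidefinite (`IsPositive` comprises both) and trace-class operators. -/
def covarianceOperators (H : Type*) [NormedAddCommGroup H] [InnerProductSpace ℝ H] :
    Set (H →L[ℝ] H) :=
  {T | T.IsPositive ∧ IsTraceClass T}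

/-- The family of operators `A τ`, `τ ∈ R`, is linearly separable with `N` terms:
`A τ = ∑ F_k(τ) C_k` for all `τ ∈ R`, with operators `C_k` that do not depend on `τ`. -/
def IsLinearlySeparable {P H : Type*} [NormedAddCommGroup H] [InnerProductSpace ℝ H]
    (N : ℕ) (R : Set P) (A : P → H →L[ℝ] H) : Prop :=
  ∃ (F : Fin N → P → ℝ) (C : Fin N → H →L[ℝ] H), ∀ τ ∈ R, A τ = ∑ k, F k τ • C k

/-! Well-definedness of the Matérn operator. -/

theorem besselK_nonneg (ν x : ℝ) : 0 ≤ besselK ν x :=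
  integral_nonneg fun t => mul_nonneg (Real.exp_pos _).le (Real.cosh_pos _).le

theorem rpow_mul_besselK_le {ν x : ℝ} (hν : 0 < ν) (hx : 0 < x) :
    x ^ ν * besselK ν x ≤ 2 ^ ν * Real.Gamma ν := by
  set g : ℝ → ℝ := fun u => Real.exp (-u) * u ^ (ν - 1) with hg
  set f : ℝ → ℝ := fun t => x / 2 * Real.exp t with hf
  have hd : ∀ t ∈ Ioi (0 : ℝ), HasDerivWithinAt f (f t) (Ioi 0) t := fun _ _ =>
    ((Real.hasDerivAt_exp _).const_mul (x / 2)).hasDerivWithinAt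
  have hinj : InjOn f (Ioi 0) := fun a _ b _ hab => by
    have : Real.exp a = Real.exp b := mul_left_cancel₀ (by positivity) hab
    exact Real.exp_injective this
  have himg : f '' Ioi 0 ⊆ Ioi 0 := by
    rintro _ ⟨t, _, rfl⟩
    exact mem_Ioi.2 (by positivity)
  have hgi : IntegrableOn g (Ioi 0) := Real.GammaIntegral_convergent hν
  have hgi' : IntegrableOn g (f '' Ioi 0) := hgi.mono_set himg
  have hci : IntegrableOn (fun t => |f t| • g (f t)) (Ioi 0) :=
    (integrableOn_image_iff_integrableOn_abs_deriv_smul measurableSet_Ioi hd hinj g).1 hgi'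
  have hcv := integral_image_eq_integral_abs_deriv_smul measurableSet_Ioi hd hinj g
  have hle : ∫ u in f '' Ioi 0, g u ≤ Real.Gamma ν := by
    rw [Real.Gamma_eq_integral hν]
    refine setIntegral_mono_set hgi ?_ (LE.le.eventuallyLE himg)
    filter_upwards [ae_restrict_mem measurableSet_Ioi] with u hu
    have : (0 : ℝ) < u := hu
    simp only [hg, Pi.zero_apply]
    positivity
  have hpt : ∀ t ∈ Ioi (0 : ℝ), x ^ ν * (Real.exp (-x * Real.cosh t) * Real.cosh (ν * t)) ≤
      2 ^ ν * (|f t| • g (f t)) := by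
    intro t ht
    have ht' : (0 : ℝ) < t := ht
    have hfp : 0 < f t := by positivity
    have h1 : |f t| • g (f t) = Real.exp (-(f t)) * (f t) ^ ν := by
      rw [abs_of_pos hfp, smul_eq_mul, hg]
      have : (f t) ^ ν = f t * f t ^ (ν - 1) := by
        rw [Real.rpow_sub_one hfp.ne']; field_simp
      rw [this]; ring
    have h2 : (2 : ℝ) ^ ν * (f t) ^ ν = x ^ ν * Real.exp (ν * t) := by
      rw [← Real.mul_rpow (by norm_num) hfp.le]
      have : 2 * f t = x * Real.exp t := by simp only [hf]; ring
      rw [this, Real.mul_rpow hx.le (Real.exp_pos _).le, ← Real.exp_mul, mul_comm t]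
    have h3 : Real.cosh (ν * t) ≤ Real.exp (ν * t) := by
      rw [Real.cosh_eq]
      have : Real.exp (-(ν * t)) ≤ Real.exp (ν * t) :=
        Real.exp_le_exp.2 (by nlinarith [mul_pos hν ht'])
      linarith
    have h4 : Real.exp (-x * Real.cosh t) ≤ Real.exp (-(f t)) := by
      refine Real.exp_le_exp.2 ?_
      rw [Real.cosh_eq]
      simp only [hf]
      nlinarith [mul_pos hx (Real.exp_pos (-t))]
    calc x ^ ν * (Real.exp (-x * Real.cosh t) * Real.cosh (ν * t))
        ≤ x ^ ν * (Real.exp (-(f t)) * Real.exp (ν * t)) := by gcongr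
      _ = Real.exp (-(f t)) * (x ^ ν * Real.exp (ν * t)) := by ring
      _ = 2 ^ ν * (|f t| • g (f t)) := by rw [h1, ← h2]; ring
  calc x ^ ν * besselK ν x
      = ∫ t in Ioi (0 : ℝ), x ^ ν * (Real.exp (-x * Real.cosh t) * Real.cosh (ν * t)) := by
        rw [besselK, integral_const_mul]
    _ ≤ ∫ t in Ioi (0 : ℝ), 2 ^ ν * (|f t| • g (f t)) := by
        refine integral_mono_of_nonneg (Eventually.of_forall fun t => ?_) (hci.const_mul _) ?_
        · exact mul_nonneg (by positivity) (mul_nonneg (Real.exp_pos _).le (Real.cosh_pos _).le)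
        · filter_upwards [ae_restrict_mem measurableSet_Ioi] with t ht using hpt t ht
    _ = 2 ^ ν * ∫ u in f '' Ioi 0, g u := by rw [integral_const_mul, hcv]
    _ ≤ 2 ^ ν * Real.Gamma ν := by gcongr

theorem measurable_besselK (ν : ℝ) : Measurable (besselK ν) := by
  have : StronglyMeasurable (Function.uncurry fun x t : ℝ =>
      Real.exp (-x * Real.cosh t) * Real.cosh (ν * t)) := by
    apply Continuous.stronglyMeasurable
    unfold Function.uncurry
    fun_prop
  exact this.integral_prod_right.measurable

theorem measurable_maternKernel (ν ℓ σ : ℝ) : Measurable (maternKernel ν ℓ σ) := by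
  unfold maternKernel
  refine Measurable.ite (measurableSet_singleton 0) measurable_const ?_
  have h := measurable_besselK ν
  fun_prop

theorem abs_maternKernel_le {ν ℓ : ℝ} (σ : ℝ) {z : ℝ} (hν : 0 < ν) (hℓ : 0 < ℓ) (hz : 0 ≤ z) :
    |maternKernel ν ℓ σ z| ≤ 2 * σ ^ 2 := by
  unfold maternKernel
  split_ifs with h
  · rw [abs_of_nonneg (sq_nonneg σ)]; nlinarith [sq_nonneg σ]
  · have hz' : 0 < z := lt_of_le_of_ne hz (Ne.symm h)
    have hx : 0 < √(2 * ν) * z / ℓ := by positivity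
    set x := √(2 * ν) * z / ℓ
    have hG := Real.Gamma_pos_of_pos hν
    have h1 := rpow_mul_besselK_le hν hx
    have h0 := besselK_nonneg ν x
    have h2 : (2 : ℝ) ^ (1 - ν) * 2 ^ ν = 2 := by
      rw [← Real.rpow_add (by norm_num)]; simp
    rw [abs_of_nonneg (by positivity)]
    calc σ ^ 2 * (2 : ℝ) ^ (1 - ν) / Real.Gamma ν * x ^ ν * besselK ν x
        = σ ^ 2 * (2 : ℝ) ^ (1 - ν) / Real.Gamma ν * (x ^ ν * besselK ν x) := by ring
      _ ≤ σ ^ 2 * (2 : ℝ) ^ (1 - ν) / Real.Gamma ν * (2 ^ ν * Real.Gamma ν) := by gcongr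
      _ = σ ^ 2 * ((2 : ℝ) ^ (1 - ν) * 2 ^ ν) := by field_simp
      _ = 2 * σ ^ 2 := by rw [h2]; ring

theorem exists_hasKernel {d : ℕ} {D : Set (EuclideanSpace ℝ (Fin d))}
    (hD : Bornology.IsBounded D)
    {k : EuclideanSpace ℝ (Fin d) → EuclideanSpace ℝ (Fin d) → ℝ}
    (hk : Measurable (Function.uncurry k)) {M : ℝ} (hM : ∀ x y, |k x y| ≤ M) :
    ∃ T : L2 D →L[ℝ] L2 D, HasKernel T k := by
  have : IsFiniteMeasure (volume.restrict D) :=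
    ⟨by rw [Measure.restrict_apply_univ]; exact hD.measure_lt_top⟩
  set μ := volume.restrict D with hμ
  have hM0 : 0 ≤ M := (abs_nonneg _).trans (hM 0 0)
  have hint : ∀ φ : L2 D, Integrable (fun x => φ x) μ := fun φ =>
    (Lp.memLp φ).integrable (by norm_num)
  have hky : ∀ y, Measurable fun x => k x y := fun y => hk.comp (measurable_id.prodMk measurable_const)
  have hintk : ∀ (φ : L2 D) (y), Integrable (fun x => φ x * k x y) μ := fun φ y =>
    (hint φ).mul_bdd (c := M) (hky y).aestronglyMeasurable
      (Eventually.of_forall fun x => by simpa using hM x y)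
  have hbd : ∀ (φ : L2 D) (y), ‖∫ x, φ x * k x y ∂μ‖ ≤ M * ∫ x, ‖φ x‖ ∂μ := by
    intro φ y
    rw [← integral_const_mul]
    refine norm_integral_le_of_norm_le ((hint φ).norm.const_mul M) (Eventually.of_forall fun x => ?_)
    rw [norm_mul, mul_comm]
    exact mul_le_mul_of_nonneg_right (hM x y) (norm_nonneg _)
  have hmeas : ∀ φ : L2 D, AEStronglyMeasurable (fun y => ∫ x, φ x * k x y ∂μ) μ := by
    intro φ
    have h1 : StronglyMeasurable (Function.uncurry fun y x => φ x * k x y) :=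
      ((Lp.stronglyMeasurable φ).comp_measurable measurable_snd).mul
        (hk.comp measurable_swap).stronglyMeasurable
    exact h1.integral_prod_right.aestronglyMeasurable
  have hmem : ∀ φ : L2 D, MemLp (fun y => ∫ x, φ x * k x y ∂μ) 2 μ := fun φ =>
    MemLp.of_bound (hmeas φ) (M * ∫ x, ‖φ x‖ ∂μ) (Eventually.of_forall (hbd φ))
  have hL1 : ∀ φ : L2 D, ∫ x, ‖φ x‖ ∂μ ≤ (μ.real univ) ^ (1 / 2 : ℝ) * ‖φ‖ := by
    intro φ
    have h := integral_mul_norm_le_Lp_mul_Lq (μ := μ) (f := fun _ => (1 : ℝ)) (g := fun x => φ x)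
      (p := 2) (q := 2) Real.HolderConjugate.two_two (memLp_const 1)
      (by simpa using Lp.memLp φ)
    have hn : ‖φ‖ = (∫ x, ‖φ x‖ ^ (2 : ℝ) ∂μ) ^ (1 / 2 : ℝ) := by
      rw [Lp.norm_def, (Lp.memLp φ).eLpNorm_eq_integral_rpow_norm (by norm_num) (by norm_num),
        ENNReal.toReal_ofReal (by positivity)]
      simp [hμ]
    rw [hn]
    simp only [norm_one, one_mul, Real.one_rpow, integral_const, smul_eq_mul, mul_one] at h
    exact h
  let L : L2 D →ₗ[ℝ] L2 D :=
    { toFun := fun φ => (hmem φ).toLp _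
      map_add' := by
        intro φ ψ
        rw [← MemLp.toLp_add]
        congr 1
        funext y
        rw [Pi.add_apply, ← integral_add (hintk φ y) (hintk ψ y)]
        refine integral_congr_ae ?_
        filter_upwards [Lp.coeFn_add φ ψ] with x hx
        rw [hx, Pi.add_apply, add_mul]
      map_smul' := by
        intro c φ
        rw [RingHom.id_apply, ← MemLp.toLp_const_smul]
        congr 1
        funext y
        rw [Pi.smul_apply, ← integral_smul]
        refine integral_congr_ae ?_
        filter_upwards [Lp.coeFn_smul c φ] with x hx
        rw [hx, Pi.smul_apply, smul_eq_mul, smul_eq_mul, mul_assoc] }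
  have hL : ∀ φ, ‖L φ‖ ≤ (measureUnivNNReal μ ^ (2 : ENNReal).toReal⁻¹ *
      (M * (μ.real univ) ^ (1 / 2 : ℝ))) * ‖φ‖ := by
    intro φ
    have h1 : ‖L φ‖ ≤ measureUnivNNReal μ ^ (2 : ENNReal).toReal⁻¹ * (M * ∫ x, ‖φ x‖ ∂μ) := by
      refine Lp.norm_le_of_ae_bound (by positivity) ?_
      filter_upwards [(hmem φ).coeFn_toLp] with y hy
      exact (congrArg norm hy).trans_le (hbd φ y)
    refine h1.trans ?_
    rw [mul_assoc, mul_assoc]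
    gcongr
    exact hL1 φ
  exact ⟨L.mkContinuous _ hL, fun φ => (hmem φ).coeFn_toLp⟩

/-- On a bounded set the Matérn operator is the integral operator with the Matérn kernel. -/
theorem maternOperator_hasKernel {d : ℕ} {D : Set (EuclideanSpace ℝ (Fin d))}
    (hD : Bornology.IsBounded D) {ν ℓ : ℝ} (σ : ℝ) (hν : 0 < ν) (hℓ : 0 < ℓ) :
    HasKernel (maternOperator D ν ℓ σ) fun x y => maternKernel ν ℓ σ (dist x y) := by
  have h : ∃ T : L2 D →L[ℝ] L2 D,
      HasKernel T fun x y => maternKernel ν ℓ σ (dist x y) := by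
    refine exists_hasKernel hD ?_ fun x y => abs_maternKernel_le σ hν hℓ dist_nonneg
    exact (measurable_maternKernel ν ℓ σ).comp measurable_dist
  unfold maternOperator integralOperator
  rw [dif_pos h]
  exact h.choose_spec

end

/-! Write the Matérn kernel as `σ² / Γ(ν) · H_ν(ν z² / (2ℓ²))` with `H_ν = besselH ν`. Its argument
is a product `Y t`, where `Y = ν z² / (2 ℓmin²)` contains the distance and `t = (ℓmin/ℓ)² ∈ (0, 1]`
the length scale; hence polynomial approximation in `t` separates the variables.

`H_ν` is smooth on `(0, ∞)` but not analytic at 0. It solves `y f'' + (1 - ν) f' = f`, and for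
non-integer `ν` the functions `F_{-ν}` and `y^ν F_ν`, with entire `F_p = frobeniusSeries p`, form a
basis of solutions. So `H_ν(Y t) = α F_{-ν}(Y t) + β Y^ν t^ν F_ν(Y t)` (`exists_besselH_eq`). Each
entire factor is replaced by a polynomial of degree `< m` in `t`, which gives `2m = N` separable
terms. For `F_ν` the partial sum at `t = 0` is enough. The coefficients of `F_{-ν}` exceed a
constant multiple of `1/(k!)²` by a power of `k`, which would spoil a constant depending on `ν`
alone; expanding about the midpoint `t = 1/2` gains a geometric factor that absorbs this. The tails
are controlled by `1/((m+i)!)² ≤ 4^m/(2m)! · 4^i/(2i)!` and the cosh series.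

It remains to pass from kernels to covariance operators. A pointwise kernel error costs a factor
`Leb(D)` in operator norm (`norm_sum_smul_sub_le`). The approximating operators need not be positive
or trace class. This is repaired in `exists_separable_positive_approx`: compress all of them by one
finite rank projection `P` and add `ε P` to the term whose coefficient is the constant 1. Since the
Matérn operator is itself positive (its kernel is a mixture of Gaussians), a shift by the
approximation error restores positivity, at the price of a factor 3. -/

/-! ### The Bessel integral `H_ν` and the Matérn kernel. -/

/-- `H_ν(y) = ∫_0^∞ s^(ν-1) exp(-s - y/s) ds`, which is `2 y^(ν/2) K_ν(2√y)` for `y > 0`. -/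
noncomputable def besselH (ν y : ℝ) : ℝ :=
  ∫ s in Ioi (0 : ℝ), s ^ (ν - 1) * Real.exp (-s - y / s)

theorem exp_neg_div_le {y s : ℝ} (hy : 0 < y) (hs : 0 < s) (n : ℕ) :
    Real.exp (-(y / s)) ≤ n.factorial / y ^ n * s ^ n := by
  have h := Real.pow_div_factorial_le_exp (y / s) (by positivity) n
  rw [Real.exp_neg]
  refine (inv_anti₀ (by positivity) h).trans (le_of_eq ?_)
  rw [div_pow]
  field_simp

/-- Near 0 the factor `exp(-y/s)` beats every negative power of `s`, so for any real `μ` a Gamma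
integrand dominates. This is what allows the order of `H` to be lowered freely. -/
theorem exists_rpow_mul_exp_neg_div_le (μ : ℝ) {y : ℝ} (hy : 0 < y) :
    ∃ C a : ℝ, 0 < C ∧ 0 < a ∧
      ∀ s : ℝ, 0 < s → s ^ μ * Real.exp (-s - y / s) ≤ C * (Real.exp (-s) * s ^ a) := by
  obtain ⟨n, hn⟩ := exists_nat_gt (-μ)
  refine ⟨n.factorial / y ^ n, μ + n, by positivity, by linarith, fun s hs => ?_⟩
  rw [sub_eq_add_neg, Real.exp_add, Real.rpow_add hs, Real.rpow_natCast]
  calc s ^ μ * (Real.exp (-s) * Real.exp (-(y / s)))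
      ≤ s ^ μ * (Real.exp (-s) * (n.factorial / y ^ n * s ^ n)) := by
        gcongr; exact exp_neg_div_le hy hs n
    _ = _ := by ring

theorem aestronglyMeasurable_besselH_integrand (μ y : ℝ) :
    AEStronglyMeasurable (fun s : ℝ => s ^ μ * Real.exp (-s - y / s))
      (volume.restrict (Ioi 0)) := by
  refine Measurable.aestronglyMeasurable ?_
  fun_prop

theorem integrableOn_besselH (μ : ℝ) {y : ℝ} (hy : 0 < y) :
    IntegrableOn (fun s : ℝ => s ^ μ * Real.exp (-s - y / s)) (Ioi 0) := by
  obtain ⟨C, a, -, ha, h⟩ := exists_rpow_mul_exp_neg_div_le μ hy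
  have hg := (Real.GammaIntegral_convergent (s := a + 1) (by linarith)).const_mul C
  refine Integrable.mono' hg (aestronglyMeasurable_besselH_integrand μ y) ?_
  filter_upwards [ae_restrict_mem measurableSet_Ioi] with s hs
  have hs : 0 < s := hs
  rw [Real.norm_of_nonneg (by positivity)]
  simpa using h s hs

theorem hasDerivAt_besselH (ν : ℝ) {y : ℝ} (hy : 0 < y) :
    HasDerivAt (besselH ν) (-besselH (ν - 1) y) y := by
  have key := hasDerivAt_integral_of_dominated_loc_of_deriv_le
    (μ := volume.restrict (Ioi (0 : ℝ)))
    (F := fun y s => s ^ (ν - 1) * Real.exp (-s - y / s))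
    (F' := fun y s => -(s ^ (ν - 1 - 1) * Real.exp (-s - y / s)))
    -- For all parameters above `y / 2` the differentiated integrand is largest at `y / 2`, where it
    -- is still integrable.
    (bound := fun s => s ^ (ν - 1 - 1) * Real.exp (-s - y / 2 / s))
    (x₀ := y) (s := Ioi (y / 2)) (Ioi_mem_nhds (by linarith))
    (Eventually.of_forall fun x => aestronglyMeasurable_besselH_integrand _ x)
    (integrableOn_besselH _ hy)
    (aestronglyMeasurable_besselH_integrand _ y).neg
    (by
      filter_upwards [ae_restrict_mem measurableSet_Ioi] with s hs x hx
      have hs : 0 < s := hs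
      have hx : y / 2 < x := hx
      rw [norm_neg, Real.norm_of_nonneg (by positivity)]
      gcongr)
    (integrableOn_besselH _ (by linarith))
    (by
      filter_upwards [ae_restrict_mem measurableSet_Ioi] with s hs x hx
      have hs : 0 < s := hs
      have h1 : HasDerivAt (fun x => -s - x / s) (-(1 / s)) x := by
        simpa using ((hasDerivAt_id x).div_const s).const_sub (-s)
      refine (h1.exp.const_mul (s ^ (ν - 1))).congr_deriv ?_
      rw [Real.rpow_sub_one hs.ne' (ν - 1)]
      ring)
  have h := key.2
  rw [integral_neg] at h
  exact h

theorem tendsto_besselH_boundary_zero (μ : ℝ) {y : ℝ} (hy : 0 < y) :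
    Tendsto (fun s : ℝ => s ^ μ * Real.exp (-s - y / s)) (𝓝[>] 0) (𝓝 0) := by
  obtain ⟨C, a, -, ha, h⟩ := exists_rpow_mul_exp_neg_div_le μ hy
  have h1 : Tendsto (fun s : ℝ => C * (Real.exp (-s) * s ^ a)) (𝓝[>] 0) (𝓝 0) := by
    have : ContinuousAt (fun s : ℝ => C * (Real.exp (-s) * s ^ a)) 0 := by
      have := Real.continuousAt_rpow_const 0 a (Or.inr ha.le)
      fun_prop
    have h2 := this.tendsto
    simp only [Real.zero_rpow ha.ne', mul_zero] at h2
    exact h2.mono_left nhdsWithin_le_nhds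
  refine tendsto_of_tendsto_of_tendsto_of_le_of_le' tendsto_const_nhds h1 ?_ ?_
  all_goals filter_upwards [self_mem_nhdsWithin] with s hs
  · have hs : 0 < s := hs
    positivity
  · exact h s hs

theorem tendsto_besselH_boundary_atTop (μ : ℝ) {y : ℝ} (hy : 0 < y) :
    Tendsto (fun s : ℝ => s ^ μ * Real.exp (-s - y / s)) atTop (𝓝 0) := by
  have h1 := tendsto_rpow_mul_exp_neg_mul_atTop_nhds_zero μ 1 one_pos
  refine tendsto_of_tendsto_of_tendsto_of_le_of_le' tendsto_const_nhds h1 ?_ ?_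
  all_goals filter_upwards [eventually_gt_atTop 0] with s hs
  · positivity
  · have : 0 < y / s := by positivity
    gcongr
    linarith

/-- The derivative of `s^μ exp(-s - y/s)` integrates to 0 over `(0, ∞)`, because both boundary
values vanish. -/
theorem besselH_recurrence (μ : ℝ) {y : ℝ} (hy : 0 < y) :
    besselH (μ + 1) y = μ * besselH μ y + y * besselH (μ - 1) y := by
  have i1 := integrableOn_besselH (μ - 1) hy
  have i2 := integrableOn_besselH (μ - 2) hy
  have i3 := integrableOn_besselH μ hy
  let f : ℝ → ℝ := fun s => s ^ μ * Real.exp (-s - y / s)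
  -- As `y / 0 = 0`, the value `f 0` is `0 ^ μ`, which is 1 for `μ = 0`; resetting it to 0 makes `f`
  -- right-continuous there.
  have hev : ∀ s : ℝ, 0 < s → Function.update f 0 0 =ᶠ[𝓝 s] f := fun s hs => by
    filter_upwards [Ioi_mem_nhds hs] with r hr
    exact Function.update_of_ne (ne_of_gt hr) _ _
  have h := integral_Ioi_of_hasDerivAt_of_tendsto
    (f := Function.update f 0 0)
    (f' := fun s => μ * (s ^ (μ - 1) * Real.exp (-s - y / s))
      - s ^ μ * Real.exp (-s - y / s) + y * (s ^ (μ - 2) * Real.exp (-s - y / s)))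
    (a := 0) (m := 0) (by
      rw [continuousWithinAt_update_same]
      refine (tendsto_besselH_boundary_zero μ hy).mono_left (nhdsWithin_mono _ ?_)
      rintro s ⟨hs, hs0⟩
      exact lt_of_le_of_ne hs (Ne.symm hs0)) (by
      intro s hs
      have hs : 0 < s := hs
      have h1 : HasDerivAt (fun s => -s - y / s) (-1 + y / s ^ 2) s := by
        have := ((hasDerivAt_id s).neg).sub ((hasDerivAt_inv hs.ne').const_mul y)
        refine (this.congr_deriv ?_).congr_of_eventuallyEq ?_
        · field_simp
          ring
        · exact Eventually.of_forall fun x => by simp [div_eq_mul_inv]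
      refine (((Real.hasDerivAt_rpow_const (p := μ) (Or.inl hs.ne')).mul h1.exp).congr_deriv
        ?_).congr_of_eventuallyEq (hev s hs)
      rw [Real.rpow_sub_one hs.ne', Real.rpow_sub hs]
      norm_num
      field_simp
      ring)
    (((i1.const_mul μ).sub i3).add (i2.const_mul y))
    ((tendsto_besselH_boundary_atTop μ hy).congr' (by
      filter_upwards [eventually_gt_atTop 0] with s hs
      exact (Function.update_of_ne hs.ne' 0 f).symm))
  have h2 : IntegrableOn (fun s => μ * (s ^ (μ - 1) * Real.exp (-s - y / s))
      - s ^ μ * Real.exp (-s - y / s)) (Ioi 0) := (i1.const_mul μ).sub i3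
  rw [Function.update_self, integral_add h2 (i2.const_mul y),
    integral_sub (i1.const_mul μ) i3, integral_const_mul, integral_const_mul] at h
  unfold besselH
  rw [add_sub_cancel_right, show μ - 1 - 1 = μ - 2 by ring]
  linarith

/-- Substitute `s = (x/2) e^t`, which maps `ℝ` onto `(0, ∞)`, then fold the two half-lines together;
`e^(νt) + e^(-νt)` produces the cosh. -/
theorem rpow_mul_besselK_eq (ν : ℝ) {x : ℝ} (hx : 0 < x) :
    x ^ ν * besselK ν x = 2 ^ (ν - 1) * besselH ν (x ^ 2 / 4) := by
  set f : ℝ → ℝ := fun t => x / 2 * Real.exp t with hf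
  set G : ℝ → ℝ := fun t => Real.exp (-x * Real.cosh t) * Real.exp (ν * t) with hG
  have hd : ∀ t ∈ (univ : Set ℝ), HasDerivWithinAt f (f t) univ t := fun _ _ =>
    ((Real.hasDerivAt_exp _).const_mul (x / 2)).hasDerivWithinAt
  have hinj : InjOn f univ := fun a _ b _ hab => by
    have : Real.exp a = Real.exp b := mul_left_cancel₀ (by positivity) hab
    exact Real.exp_injective this
  have himg : f '' univ = Ioi 0 := by
    rw [image_univ]
    ext s
    refine ⟨?_, fun hs => ⟨Real.log (2 * s / x), ?_⟩⟩
    · rintro ⟨t, rfl⟩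
      exact mem_Ioi.2 (by positivity)
    · have hs : 0 < s := hs
      simp only [hf]
      rw [Real.exp_log (by positivity)]
      field_simp
  have hpt : ∀ t, |f t| • ((f t) ^ (ν - 1) * Real.exp (-(f t) - x ^ 2 / 4 / f t)) =
      (x / 2) ^ ν * G t := by
    intro t
    have hfp : 0 < f t := by positivity
    rw [abs_of_pos hfp, smul_eq_mul, Real.rpow_sub_one hfp.ne']
    have h1 : (f t) ^ ν = (x / 2) ^ ν * Real.exp (ν * t) := by
      rw [hf, Real.mul_rpow (by positivity) (Real.exp_pos _).le, ← Real.exp_mul, mul_comm t]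
    have h2 : -(f t) - x ^ 2 / 4 / f t = -x * Real.cosh t := by
      simp only [hf]
      rw [Real.cosh_eq, Real.exp_neg]
      field_simp
      ring
    rw [h1, h2, hG]
    field_simp
  have hi := integrableOn_besselH (ν - 1) (y := x ^ 2 / 4) (by positivity)
  rw [← himg, integrableOn_image_iff_integrableOn_abs_deriv_smul MeasurableSet.univ hd hinj] at hi
  simp only [hpt, integrableOn_univ] at hi
  have hGi : Integrable G := by
    have := hi.const_mul ((x / 2) ^ ν)⁻¹
    refine this.congr (Eventually.of_forall fun t => ?_)
    have : (x / 2) ^ ν ≠ 0 := by positivity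
    field_simp
  have hH : besselH ν (x ^ 2 / 4) = (x / 2) ^ ν * ∫ t, G t := by
    unfold besselH
    rw [← himg, integral_image_eq_integral_abs_deriv_smul MeasurableSet.univ hd hinj]
    simp only [hpt]
    rw [integral_const_mul, Measure.restrict_univ]
  have hsplit : ∫ t, G t = 2 * besselK ν x := by
    rw [← intervalIntegral.integral_Iic_add_Ioi hGi.integrableOn hGi.integrableOn (b := 0)]
    have h1 : ∫ t in Iic 0, G t = ∫ t in Ioi 0, G (-t) := by
      rw [integral_comp_neg_Ioi, neg_zero]
    have h2 : IntegrableOn (fun t => G (-t)) (Ioi 0) := hGi.comp_neg.integrableOn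
    rw [h1, ← integral_add h2 hGi.integrableOn, besselK, ← integral_const_mul]
    congr 1
    funext t
    simp only [hG]
    rw [Real.cosh_neg, Real.cosh_eq (ν * t), mul_neg]
    ring
  rw [hH, hsplit, Real.div_rpow hx.le (by norm_num), Real.rpow_sub_one (by norm_num)]
  field_simp

theorem maternKernel_eq_besselH {ν ℓ z : ℝ} (σ : ℝ) (hν : 0 < ν) (hℓ : 0 < ℓ) (hz : 0 < z) :
    maternKernel ν ℓ σ z =
      σ ^ 2 / Real.Gamma ν * besselH ν (ν * z ^ 2 / (2 * ℓ ^ 2)) := by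
  have hx : 0 < √(2 * ν) * z / ℓ := by positivity
  have h := rpow_mul_besselK_eq ν hx
  have h2 : (√(2 * ν) * z / ℓ) ^ 2 / 4 = ν * z ^ 2 / (2 * ℓ ^ 2) := by
    rw [div_pow, mul_pow, Real.sq_sqrt (by positivity)]
    field_simp
    ring
  rw [h2] at h
  unfold maternKernel
  rw [if_neg hz.ne', mul_assoc, h]
  have h3 : (2 : ℝ) ^ (1 - ν) * 2 ^ (ν - 1) = 1 := by
    rw [← Real.rpow_add (by norm_num)]; simp
  linear_combination (σ ^ 2 / Real.Gamma ν * besselH ν (ν * z ^ 2 / (2 * ℓ ^ 2))) * h3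

/-! ### The Frobenius series `F_p`. -/

/-- Coefficients of the Frobenius solution `∑ y^k / (k! Γ(k+1+p))`. -/
noncomputable def frobeniusCoeff (p : ℝ) (k : ℕ) : ℝ :=
  ((k.factorial : ℝ) * Real.Gamma (k + 1 + p))⁻¹

/-- `F_p(y) = ∑ y^k / (k! Γ(k+1+p))`, so that `F_p(y) = y^(-p/2) I_p(2√y)` for `y > 0`. -/
noncomputable def frobeniusSeries (p y : ℝ) : ℝ := ∑' k : ℕ, frobeniusCoeff p k * y ^ k

/-- The normalised coefficients `r k` satisfy `r (k+1) = r k · q (k+1) / (k+1+p)` for large `k`, so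
they eventually decrease and hence are bounded. Any `q < 1` is admissible for every `p`, and `q = 1`
for `p ≥ 0`. -/
theorem exists_abs_frobeniusCoeff_le {p q : ℝ} (hq : 0 < q)
    (h : ∀ᶠ k : ℕ in atTop, q * (k + 1) ≤ k + 1 + p) :
    ∃ C : ℝ, 0 < C ∧ ∀ k : ℕ,
      |frobeniusCoeff p k| ≤ C * ((1 / q) ^ k / (k.factorial : ℝ) ^ 2) := by
  obtain ⟨k₀, hk₀⟩ := eventually_atTop.1 h
  set r : ℕ → ℝ := fun k => |frobeniusCoeff p k| * ((k.factorial : ℝ) ^ 2 * q ^ k) with hr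
  have hr0 : ∀ k, 0 ≤ r k := fun k => by positivity
  have hstep : ∀ k, k₀ ≤ k → r (k + 1) ≤ r k := by
    intro k hk
    have h1 := hk₀ k hk
    have h2 : 0 < k + 1 + p := lt_of_lt_of_le (by positivity) h1
    have h3 : frobeniusCoeff p (k + 1) =
        frobeniusCoeff p k * (((k : ℝ) + 1) * (k + 1 + p))⁻¹ := by
      unfold frobeniusCoeff
      rw [Nat.factorial_succ, Nat.cast_mul, Nat.cast_succ,
        show (k : ℝ) + 1 + 1 + p = (k + 1 + p) + 1 by ring, Real.Gamma_add_one h2.ne',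
        ← mul_inv]
      congr 1
      ring
    have h4 : r (k + 1) = r k * (q * (k + 1) / (k + 1 + p)) := by
      simp only [hr]
      rw [h3, abs_mul, abs_of_pos (a := (((k : ℝ) + 1) * (k + 1 + p))⁻¹) (by positivity),
        Nat.factorial_succ, Nat.cast_mul, Nat.cast_succ, pow_succ q]
      field_simp
    rw [h4]
    exact mul_le_of_le_one_right (hr0 k) ((div_le_one h2).2 h1)
  have hsum : ∀ k, r k ≤ ∑ i ∈ Finset.range (k₀ + 1), r i := by
    intro k
    rcases lt_or_ge k (k₀ + 1) with hk | hk
    · exact Finset.single_le_sum (f := r) (fun i _ => hr0 i) (Finset.mem_range.2 hk)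
    · have : r k ≤ r k₀ := by
        induction k, (show k₀ ≤ k by omega) using Nat.le_induction with
        | base => exact le_rfl
        | succ n hn ih =>
          refine (hstep n hn).trans ?_
          rcases eq_or_lt_of_le hn with rfl | hn'
          · exact le_rfl
          · exact ih (by omega)
      exact this.trans (Finset.single_le_sum (f := r) (fun i _ => hr0 i)
        (Finset.mem_range.2 (by omega)))
  refine ⟨∑ i ∈ Finset.range (k₀ + 1), r i + 1,
    add_pos_of_nonneg_of_pos (Finset.sum_nonneg fun i _ => hr0 i) one_pos, fun k => ?_⟩
  have h1 : |frobeniusCoeff p k| = r k * ((1 / q) ^ k / (k.factorial : ℝ) ^ 2) := by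
    simp only [hr]
    rw [div_pow, one_pow]
    field_simp
  rw [h1]
  gcongr
  linarith [hsum k]

theorem eventually_mul_succ_le (p : ℝ) {q : ℝ} (hq : q < 1) :
    ∀ᶠ k : ℕ in atTop, q * (k + 1) ≤ k + 1 + p := by
  obtain ⟨n, hn⟩ := exists_nat_gt (-p / (1 - q))
  filter_upwards [eventually_ge_atTop n] with k hk
  have h1 : (n : ℝ) ≤ k := by exact_mod_cast hk
  have h2 : -p < n * (1 - q) := (div_lt_iff₀ (by linarith)).1 hn
  nlinarith

theorem exists_abs_frobeniusCoeff_le_two (p : ℝ) :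
    ∃ C : ℝ, 0 < C ∧ ∀ k : ℕ,
      |frobeniusCoeff p k| ≤ C * (2 ^ k / (k.factorial : ℝ) ^ 2) := by
  obtain ⟨C, h0, hC⟩ := exists_abs_frobeniusCoeff_le (p := p) (q := 1 / 2) (by norm_num)
    (eventually_mul_succ_le p (by norm_num))
  exact ⟨C, h0, by simpa using hC⟩

theorem summable_frobenius (p y : ℝ) : Summable fun k => frobeniusCoeff p k * y ^ k := by
  obtain ⟨C, h0, hC⟩ := exists_abs_frobeniusCoeff_le_two p
  refine Summable.of_norm_bounded ((Real.summable_pow_div_factorial (2 * |y|)).mul_left C)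
    fun k => ?_
  rw [norm_mul, norm_pow, Real.norm_eq_abs, Real.norm_eq_abs]
  have h1 : (1 : ℝ) ≤ k.factorial := by exact_mod_cast k.factorial_pos
  calc |frobeniusCoeff p k| * |y| ^ k
      ≤ C * (2 ^ k / (k.factorial : ℝ) ^ 2) * |y| ^ k := by gcongr; exact hC k
    _ ≤ C * (2 ^ k / (k.factorial : ℝ)) * |y| ^ k := by
        gcongr
        exact le_self_pow₀ h1 two_ne_zero
    _ = _ := by rw [mul_pow]; ring

theorem frobeniusCoeff_succ_mul (p : ℝ) (k : ℕ) :
    frobeniusCoeff p (k + 1) * (k + 1) = frobeniusCoeff (p + 1) k := by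
  unfold frobeniusCoeff
  rw [Nat.factorial_succ, Nat.cast_mul, Nat.cast_succ,
    show (k : ℝ) + 1 + 1 + p = k + 1 + (p + 1) by ring]
  have : (k : ℝ) + 1 ≠ 0 := by positivity
  field_simp

theorem hasDerivAt_frobenius (p y : ℝ) : HasDerivAt (frobeniusSeries p) (frobeniusSeries (p + 1) y) y := by
  obtain ⟨C, h0, hC⟩ := exists_abs_frobeniusCoeff_le_two p
  set R : ℝ := |y| + 1 with hR
  have hR1 : 1 ≤ R := by have := abs_nonneg y; linarith
  have key := hasDerivAt_tsum_of_isPreconnected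
    (u := fun k : ℕ => C * ((2 * R) ^ k / k.factorial))
    (g := fun (k : ℕ) (x : ℝ) => frobeniusCoeff p k * x ^ k)
    (g' := fun (k : ℕ) (x : ℝ) => frobeniusCoeff p k * (k * x ^ (k - 1)))
    (t := Metric.ball 0 R) (y₀ := 0) (y := y)
    ((Real.summable_pow_div_factorial (2 * R)).mul_left C) Metric.isOpen_ball
    (convex_ball 0 R).isPreconnected
    (fun k x _ => (hasDerivAt_pow k x).const_mul _)
    (fun k x hx => by
      have hx : |x| ≤ R := by simpa using (Metric.mem_ball.1 hx).le
      have h2 : (k : ℝ) ≤ k.factorial := by exact_mod_cast k.self_le_factorial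
      have h3 : |x| ^ (k - 1) ≤ R ^ k :=
        (pow_le_pow_left₀ (abs_nonneg x) hx _).trans (pow_le_pow_right₀ hR1 (Nat.sub_le _ _))
      rw [norm_mul, norm_mul, norm_pow, Real.norm_eq_abs, Real.norm_eq_abs, Real.norm_eq_abs,
        Nat.abs_cast]
      calc |frobeniusCoeff p k| * (k * |x| ^ (k - 1))
          ≤ C * (2 ^ k / (k.factorial : ℝ) ^ 2) * (k.factorial * R ^ k) := by
            gcongr; exact hC k
        _ = _ := by rw [mul_pow]; field_simp)
    (Metric.mem_ball_self (by linarith)) (summable_frobenius p 0)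
    (by simp [hR])
  refine key.congr_deriv ?_
  unfold frobeniusSeries
  have hs : ∀ k : ℕ, frobeniusCoeff p (k + 1) * (((k + 1 : ℕ) : ℝ) * y ^ (k + 1 - 1)) =
      frobeniusCoeff (p + 1) k * y ^ k := fun k => by
    rw [← frobeniusCoeff_succ_mul, Nat.cast_succ, Nat.add_sub_cancel]; ring
  have hsum : Summable fun k : ℕ => frobeniusCoeff p k * (k * y ^ (k - 1)) := by
    rw [← summable_nat_add_iff 1]
    simp only [hs]
    exact summable_frobenius _ _
  rw [hsum.tsum_eq_zero_add]
  simp only [hs]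
  simp

/-- Compare coefficients: `1/Γ(s) = s/Γ(s+1)` at `s = k + 1 + p`, and `s = (1 + p) + k`, where the
share `k` cancels against `k!` and shifts the index. Together with `F_p' = F_{p+1}` this is the
differential equation. -/
theorem frobenius_recurrence {p : ℝ} (hp : ∀ k : ℕ, (k : ℝ) + 1 + p ≠ 0) (y : ℝ) :
    frobeniusSeries p y = (1 + p) * frobeniusSeries (p + 1) y + y * frobeniusSeries (p + 2) y := by
  unfold frobeniusSeries
  rw [(summable_frobenius p y).tsum_eq_zero_add, (summable_frobenius (p + 1) y).tsum_eq_zero_add,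
    mul_add, ← tsum_mul_left, ← tsum_mul_left, add_assoc, ← Summable.tsum_add]
  · congr 1
    · have h := hp 0
      unfold frobeniusCoeff
      simp only [Nat.cast_zero, zero_add] at h ⊢
      rw [show 1 + (p + 1) = (1 + p) + 1 by ring, Real.Gamma_add_one h]
      simp only [Nat.factorial_zero, Nat.cast_one, one_mul, pow_zero, mul_one]
      field_simp
    · refine tsum_congr fun k => ?_
      have h := hp (k + 1)
      unfold frobeniusCoeff
      push_cast at h ⊢
      rw [show (k : ℝ) + 1 + 1 + (p + 1) = (k + 1 + 1 + p) + 1 by ring,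
        show (k : ℝ) + 1 + (p + 2) = (k + 1 + 1 + p) + 1 by ring, Real.Gamma_add_one h,
        Nat.factorial_succ, Nat.cast_mul, Nat.cast_succ, mul_inv, mul_inv, mul_inv, mul_inv,
        mul_inv]
      have h2 : (k : ℝ) + 1 ≠ 0 := by positivity
      field_simp
      ring
  · exact ((summable_nat_add_iff 1).2 (summable_frobenius (p + 1) y)).mul_left _
  · exact (summable_frobenius (p + 2) y).mul_left _

/-! ### Wronskians and the connection formula. -/

theorem frobenius_zero (p : ℝ) : frobeniusSeries p 0 = (Real.Gamma (1 + p))⁻¹ := by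
  unfold frobeniusSeries
  rw [tsum_eq_single 0 (fun k hk => by simp [hk])]
  simp [frobeniusCoeff]

/-- For `y > 0` the left side is `y^(1-ν)` times the Wronskian of `F_{-ν}` and `y^ν F_ν`, since
`(y^ν F_ν)' = y^(ν-1) F_{ν-1}`. In this form it is differentiable on all of `ℝ`, so its constant
value can be read off at 0. -/
theorem frobeniusSeries_wronskian {ν : ℝ} (hν : 0 < ν) (hνℕ : ∀ n : ℕ, ν ≠ n) (y : ℝ) :
    frobeniusSeries (-ν) y * frobeniusSeries (ν - 1) y
      - y * (frobeniusSeries (1 - ν) y * frobeniusSeries ν y)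
      = (Real.Gamma (1 - ν))⁻¹ * (Real.Gamma ν)⁻¹ := by
  have hd : ∀ x, HasDerivAt (fun y => frobeniusSeries (-ν) y * frobeniusSeries (ν - 1) y
      - y * (frobeniusSeries (1 - ν) y * frobeniusSeries ν y)) 0 x := by
    intro x
    have h1 := hasDerivAt_frobenius (-ν) x
    have h2 := hasDerivAt_frobenius (ν - 1) x
    have h3 := hasDerivAt_frobenius (1 - ν) x
    have h4 := hasDerivAt_frobenius ν x
    have r1 := frobenius_recurrence (p := -ν) (fun k hk => hνℕ (k + 1) (by push_cast; linarith)) x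
    have r2 := frobenius_recurrence (p := ν - 1)
      (fun k hk => by have : (0 : ℝ) ≤ k := k.cast_nonneg; linarith) x
    rw [sub_add_cancel] at h2 r2
    rw [show -ν + 1 = 1 - ν by ring] at h1 r1
    rw [show 1 - ν + 1 = -ν + 2 by ring] at h3
    rw [show ν - 1 + 2 = ν + 1 by ring] at r2
    refine ((h1.mul h2).sub ((hasDerivAt_id x).mul (h3.mul h4))).congr_deriv ?_
    simp only [id, Pi.mul_apply]
    rw [r1, r2]
    ring
  have h := is_const_of_deriv_eq_zero (fun x => (hd x).differentiableAt)
    (fun x => (hd x).deriv) y 0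
  simpa only [zero_mul, sub_zero, frobenius_zero, ← sub_eq_add_neg, add_sub_cancel] using h

/-- Off the integers, `H_ν` is a combination of the two Frobenius solutions. -/
theorem exists_besselH_eq {ν : ℝ} (hν : 0 < ν) (hνℕ : ∀ n : ℕ, ν ≠ n) :
    ∃ α β : ℝ, ∀ y : ℝ, 0 < y →
      besselH ν y = α * frobeniusSeries (-ν) y + β * (y ^ ν * frobeniusSeries ν y) := by
  have rec1 : ∀ x, frobeniusSeries (-ν) x =
      (1 - ν) * frobeniusSeries (1 - ν) x + x * frobeniusSeries (-ν + 2) x := fun x => by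
    have := frobenius_recurrence (p := -ν)
      (fun k hk => hνℕ (k + 1) (by push_cast; linarith)) x
    rwa [show -ν + 1 = 1 - ν by ring, show 1 + -ν = 1 - ν by ring] at this
  have rec2 : ∀ x, frobeniusSeries (ν - 1) x =
      ν * frobeniusSeries ν x + x * frobeniusSeries (ν + 1) x := fun x => by
    have := frobenius_recurrence (p := ν - 1)
      (fun k hk => by have : (0 : ℝ) ≤ k := k.cast_nonneg; linarith) x
    rwa [sub_add_cancel, show ν - 1 + 2 = ν + 1 by ring, show 1 + (ν - 1) = ν by ring] at this
  have hh : ∀ x, 0 < x → HasDerivAt (besselH ν) (-besselH (ν - 1) x) x := fun x hx =>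
    hasDerivAt_besselH ν hx
  have hg : ∀ x, 0 < x → HasDerivAt (besselH (ν - 1)) (-besselH (ν - 2) x) x := fun x hx => by
    have := hasDerivAt_besselH (ν - 1) hx
    rwa [show ν - 1 - 1 = ν - 2 by ring] at this
  have recH : ∀ x, 0 < x → besselH ν x = (ν - 1) * besselH (ν - 1) x + x * besselH (ν - 2) x :=
    fun x hx => by
      have := besselH_recurrence (ν - 1) hx
      rwa [sub_add_cancel, show ν - 1 - 1 = ν - 2 by ring] at this
  have F1 : ∀ x, HasDerivAt (frobeniusSeries (-ν)) (frobeniusSeries (1 - ν) x) x := fun x => by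
    have := hasDerivAt_frobenius (-ν) x
    rwa [show -ν + 1 = 1 - ν by ring] at this
  have F2 : ∀ x, HasDerivAt (frobeniusSeries (1 - ν)) (frobeniusSeries (-ν + 2) x) x := fun x => by
    have := hasDerivAt_frobenius (1 - ν) x
    rwa [show 1 - ν + 1 = -ν + 2 by ring] at this
  have F3 : ∀ x, HasDerivAt (frobeniusSeries (ν - 1)) (frobeniusSeries ν x) x := fun x => by
    have := hasDerivAt_frobenius (ν - 1) x
    rwa [sub_add_cancel] at this
  have F4 := hasDerivAt_frobenius ν
  -- `x^(1-ν)` times the Wronskian of `H_ν` and `x^ν F_ν`, with the powers cancelled.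
  obtain ⟨c₁, hc₁⟩ : ∃ c, ∀ x ∈ Ioi (0 : ℝ), besselH ν x * frobeniusSeries (ν - 1) x
      + x * (besselH (ν - 1) x * frobeniusSeries ν x) = c := by
    have hd : ∀ x ∈ Ioi (0 : ℝ), HasDerivAt (fun x => besselH ν x * frobeniusSeries (ν - 1) x
        + x * (besselH (ν - 1) x * frobeniusSeries ν x)) 0 x := by
      intro x hx
      refine (((hh x hx).mul (F3 x)).add ((hasDerivAt_id x).mul
        ((hg x hx).mul (F4 x)))).congr_deriv ?_
      simp only [id, Pi.mul_apply]
      rw [rec2, recH x hx]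
      ring
    exact isOpen_Ioi.exists_is_const_of_deriv_eq_zero isPreconnected_Ioi
      (fun x hx => (hd x hx).differentiableAt.differentiableWithinAt) fun x hx => (hd x hx).deriv
  -- `x^(1-ν)` times the Wronskian of `H_ν` and `F_{-ν}`.
  obtain ⟨c₂, hc₂⟩ : ∃ c, ∀ x ∈ Ioi (0 : ℝ), x ^ (1 - ν) *
      (besselH ν x * frobeniusSeries (1 - ν) x + besselH (ν - 1) x * frobeniusSeries (-ν) x)
        = c := by
    have hd : ∀ x ∈ Ioi (0 : ℝ), HasDerivAt (fun x => x ^ (1 - ν) *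
        (besselH ν x * frobeniusSeries (1 - ν) x
          + besselH (ν - 1) x * frobeniusSeries (-ν) x)) 0 x := by
      intro x hx
      have hx' : x ≠ 0 := ne_of_gt hx
      refine ((Real.hasDerivAt_rpow_const (p := 1 - ν) (Or.inl hx')).mul
        (((hh x hx).mul (F2 x)).add ((hg x hx).mul (F1 x)))).congr_deriv ?_
      simp only [Pi.mul_apply, Pi.add_apply]
      rw [rec1, recH x hx, Real.rpow_sub_one hx']
      field_simp
      ring
    exact isOpen_Ioi.exists_is_const_of_deriv_eq_zero isPreconnected_Ioi
      (fun x hx => (hd x hx).differentiableAt.differentiableWithinAt) fun x hx => (hd x hx).deriv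
  set c₀ : ℝ := (Real.Gamma (1 - ν))⁻¹ * (Real.Gamma ν)⁻¹ with hc₀
  have hne : c₀ ≠ 0 := by
    refine mul_ne_zero (inv_ne_zero ?_) (inv_ne_zero (Real.Gamma_pos_of_pos hν).ne')
    exact Real.Gamma_ne_zero fun m hm => hνℕ (m + 1) (by push_cast; linarith)
  -- Cramer's rule: the two Wronskians with `H_ν` determine it once `c₀ ≠ 0`, which is where
  -- non-integrality of `ν` enters.
  refine ⟨c₁ / c₀, -(c₂ / c₀), fun y hy => ?_⟩
  have h0 := frobeniusSeries_wronskian hν hνℕ y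
  have h1 := hc₁ y hy
  have h2 := hc₂ y hy
  have h3 : y ^ ν * y ^ (1 - ν) = y := by rw [← Real.rpow_add hy]; simp
  have h4 : c₀ * besselH ν y =
      c₁ * frobeniusSeries (-ν) y - c₂ * (y ^ ν * frobeniusSeries ν y) := by
    rw [← h1, ← h2, hc₀, ← h0]
    linear_combination (-frobeniusSeries ν y * (besselH ν y * frobeniusSeries (1 - ν) y
          + besselH (ν - 1) y * frobeniusSeries (-ν) y)) * (-h3)
  field_simp
  linear_combination h4

/-! ### Tail estimates for the truncated expansions. -/

/-- The central binomial coefficient gives `(2n)! ≤ 4^n (n!)²` with `n = m + i`, and `(2m)! (2i)!`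
divides `(2n)!`. -/
theorem inv_factorial_sq_le (m i : ℕ) :
    1 / ((m + i).factorial : ℝ) ^ 2 ≤
      4 ^ m / ((2 * m).factorial : ℝ) * (4 ^ i / ((2 * i).factorial : ℝ)) := by
  have h1 : (2 * (m + i)).factorial ≤ 4 ^ (m + i) * ((m + i).factorial) ^ 2 := by
    have h := Nat.choose_mul_factorial_mul_factorial (n := 2 * (m + i)) (k := m + i) (by omega)
    rw [show 2 * (m + i) - (m + i) = m + i by omega] at h
    have h2 : (2 * (m + i)).choose (m + i) ≤ 4 ^ (m + i) := by
      have := Nat.choose_le_two_pow (2 * (m + i)) (m + i)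
      rwa [pow_mul] at this
    calc (2 * (m + i)).factorial
        = (2 * (m + i)).choose (m + i) * ((m + i).factorial) ^ 2 := by rw [← h]; ring
      _ ≤ _ := Nat.mul_le_mul_right _ h2
  have h2 : (2 * m).factorial * (2 * i).factorial ≤ (2 * (m + i)).factorial := by
    rw [mul_add]
    exact Nat.le_of_dvd (Nat.factorial_pos _) (Nat.factorial_mul_factorial_dvd_factorial_add _ _)
  have h3 : ((2 * m).factorial : ℝ) * (2 * i).factorial ≤
      4 ^ (m + i) * ((m + i).factorial : ℝ) ^ 2 := by exact_mod_cast h2.trans h1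
  rw [div_mul_div_comm, div_le_div_iff₀ (by positivity) (by positivity), one_mul, ← pow_add]
  exact h3

/-- After the factor belonging to `m` is pulled out, what remains is `∑ (8Y)^i / (2i)! = cosh
√(8Y)`. -/
theorem abs_tsum_le_of_factorial_bound {f : ℕ → ℝ} (hf : Summable f) {m : ℕ}
    (h0 : ∀ k < m, f k = 0) {C Y : ℝ} (hC : 0 ≤ C) (hY : 0 ≤ Y)
    (h : ∀ i, |f (m + i)| ≤ C * (2 ^ i * Y ^ (m + i) * (1 / ((m + i).factorial : ℝ) ^ 2))) :
    |∑' k, f k| ≤ C * ((4 * Y) ^ m / ((2 * m).factorial : ℝ)) * Real.exp (√(8 * Y)) := by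
  rw [← hf.sum_add_tsum_nat_add m,
    Finset.sum_eq_zero (fun k hk => h0 k (Finset.mem_range.1 hk)), zero_add]
  have hs := (Real.hasSum_cosh (√(8 * Y))).mul_left
    (C * ((4 * Y) ^ m / ((2 * m).factorial : ℝ)))
  have hle : ∀ i, ‖f (i + m)‖ ≤ C * ((4 * Y) ^ m / ((2 * m).factorial : ℝ)) *
      (√(8 * Y) ^ (2 * i) / ((2 * i).factorial : ℝ)) := by
    intro i
    rw [Real.norm_eq_abs, add_comm, pow_mul, Real.sq_sqrt (by positivity)]
    refine (h i).trans ?_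
    rw [mul_assoc C]
    refine mul_le_mul_of_nonneg_left ?_ hC
    calc 2 ^ i * Y ^ (m + i) * (1 / ((m + i).factorial : ℝ) ^ 2)
        ≤ 2 ^ i * Y ^ (m + i) * (4 ^ m / ((2 * m).factorial : ℝ) *
          (4 ^ i / ((2 * i).factorial : ℝ))) := by
          gcongr; exact inv_factorial_sq_le m i
      _ = _ := by
          rw [show (8 : ℝ) = 2 * 4 by norm_num, mul_pow, mul_pow, mul_pow, pow_add]
          ring
  refine (tsum_of_norm_bounded hs hle).trans ?_
  gcongr
  rw [Real.cosh_eq]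
  have : Real.exp (-√(8 * Y)) ≤ Real.exp (√(8 * Y)) :=
    Real.exp_le_exp.2 (by have := Real.sqrt_nonneg (8 * Y); linarith)
  linarith

/-- The Taylor polynomial of degree `< m` of `t ↦ t ^ k` at `t = 1/2` is exact for `k < m`. -/
theorem pow_eq_taylor_half (t : ℝ) {m k : ℕ} (hk : k < m) :
    t ^ k = ∑ j ∈ Finset.range m, (2 * t - 1) ^ j * (k.choose j * (1 / 2) ^ k) := by
  have h := add_pow (2 * t - 1) 1 k
  have h2 : ∑ j ∈ Finset.range (k + 1), (2 * t - 1) ^ j * (k.choose j * (1 / 2) ^ k) =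
      ∑ j ∈ Finset.range m, (2 * t - 1) ^ j * (k.choose j * (1 / 2) ^ k) := by
    refine Finset.sum_subset (Finset.range_subset_range.2 hk) fun j _ hj => ?_
    rw [Nat.choose_eq_zero_of_lt (by simpa using hj)]
    simp
  rw [← h2]
  simp only [one_pow, mul_one, sub_add_cancel] at h
  simp only [← mul_assoc]
  rw [← Finset.sum_mul, ← h, ← mul_pow]
  ring

/-- Only terms with `j ≥ m` are left, and there `1 ≤ (1/2)^m 2^j`. Inserting this weight and
completing the binomial sum gives `(1/2)^m (3/2)^(m+i)`. -/
theorem abs_pow_sub_taylor_half_le {t : ℝ} (ht0 : 0 ≤ t) (ht1 : t ≤ 1) (m i : ℕ) :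
    |t ^ (m + i) - ∑ j ∈ Finset.range m,
        (2 * t - 1) ^ j * ((m + i).choose j * (1 / 2) ^ (m + i))| ≤
      (3 / 4) ^ m * (3 / 2) ^ i := by
  have hu : |2 * t - 1| ≤ 1 := abs_le.2 ⟨by linarith, by linarith⟩
  rw [pow_eq_taylor_half t (Nat.lt_succ_self (m + i)),
    ← Finset.sum_range_add_sum_Ico _ (show m ≤ m + i + 1 by omega), add_sub_cancel_left]
  have h3 : ((3 : ℝ) / 4) ^ m * (3 / 2) ^ i = (1 / 2) ^ m * ((1 / 2) ^ (m + i) *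
      ∑ j ∈ Finset.range (m + i + 1), (2 : ℝ) ^ j * ((m + i).choose j : ℝ)) := by
    have h := add_pow (2 : ℝ) 1 (m + i)
    simp only [one_pow, mul_one] at h
    rw [← h, pow_add, pow_add, show (2 : ℝ) + 1 = 3 by norm_num,
      show (3 : ℝ) / 4 = 1 / 2 * (1 / 2) * 3 by norm_num, show (3 : ℝ) / 2 = 1 / 2 * 3 by norm_num,
      mul_pow, mul_pow, mul_pow]
    ring
  rw [h3, Finset.mul_sum, Finset.mul_sum]
  refine (Finset.abs_sum_le_sum_abs _ _).trans ?_
  calc ∑ j ∈ Finset.Ico m (m + i + 1),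
        |(2 * t - 1) ^ j * ((m + i).choose j * (1 / 2) ^ (m + i))|
      ≤ ∑ j ∈ Finset.Ico m (m + i + 1),
        (1 / 2) ^ m * ((1 / 2) ^ (m + i) * (2 ^ j * ((m + i).choose j : ℝ))) := by
        refine Finset.sum_le_sum fun j hj => ?_
        have hj := (Finset.mem_Ico.1 hj).1
        have h4 : (1 : ℝ) ≤ (1 / 2) ^ m * 2 ^ j := by
          calc (1 : ℝ) = (1 / 2) ^ m * 2 ^ m := by rw [← mul_pow]; norm_num
            _ ≤ _ := by gcongr; norm_num
        have h5 : |2 * t - 1| ^ j ≤ 1 := pow_le_one₀ (abs_nonneg _) hu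
        rw [abs_mul, abs_pow, abs_of_nonneg (a := ((m + i).choose j : ℝ) * (1 / 2) ^ (m + i))
          (by positivity)]
        calc |2 * t - 1| ^ j * (((m + i).choose j : ℝ) * (1 / 2) ^ (m + i))
            ≤ ((1 / 2) ^ m * 2 ^ j) * (((m + i).choose j : ℝ) * (1 / 2) ^ (m + i)) := by
              gcongr; exact h5.trans h4
          _ = _ := by ring
    _ ≤ _ := by
        refine Finset.sum_le_sum_of_subset_of_nonneg ?_ fun j _ _ => by positivity
        intro j hj
        exact Finset.mem_range.2 (Finset.mem_Ico.1 hj).2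

/-- These are the coefficients of `(2t - 1)^j` in the Taylor series of `t ↦ F_p(Y t)` at `t = 1/2`,
because the `j`-th derivative of `F_p` is `F_{p+j}`. -/
theorem hasSum_frobenius_choose (p Y : ℝ) (j : ℕ) :
    HasSum (fun k : ℕ => frobeniusCoeff p k * Y ^ k * (k.choose j * (1 / 2) ^ k))
      ((Y / 2) ^ j / j.factorial * frobeniusSeries (p + j) (Y / 2)) := by
  have h1 := (summable_frobenius (p + j) (Y / 2)).hasSum.mul_left ((Y / 2) ^ j / j.factorial)
  rw [← hasSum_nat_add_iff' j, Finset.sum_eq_zero, sub_zero]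
  · refine h1.congr_fun ?_
    intro i
    have h2 : ((i + j).choose j : ℝ) = (i + j).factorial / (i.factorial * j.factorial) := by
      rw [Nat.cast_choose ℝ (by omega), Nat.add_sub_cancel, mul_comm]
    unfold frobeniusCoeff
    rw [h2, show (((i + j : ℕ) : ℝ) + 1 + p) = i + 1 + (p + j) by push_cast; ring, mul_inv,
      mul_inv]
    field_simp
    ring
  · intro k hk
    rw [Nat.choose_eq_zero_of_lt (Finset.mem_range.1 hk)]
    simp

/-- The gain `(3/4)^m` of the midpoint expansion cancels the coefficient growth `(4/3)^m` exactly;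
the leftover `(4/3 · 3/2)^i = 2^i` only affects the exponential. -/
theorem abs_frobenius_sub_taylor_le {p C Y t : ℝ} (hC : 0 ≤ C)
    (h : ∀ k : ℕ, |frobeniusCoeff p k| ≤ C * ((4 / 3) ^ k / (k.factorial : ℝ) ^ 2))
    (hY : 0 ≤ Y) (ht0 : 0 ≤ t) (ht1 : t ≤ 1) (m : ℕ) :
    |frobeniusSeries p (Y * t) - ∑ j ∈ Finset.range m, (2 * t - 1) ^ j *
        ((Y / 2) ^ j / j.factorial * frobeniusSeries (p + j) (Y / 2))| ≤
      C * ((4 * Y) ^ m / ((2 * m).factorial : ℝ)) * Real.exp (√(8 * Y)) := by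
  have h1 := (summable_frobenius p (Y * t)).hasSum.sub (hasSum_sum (s := Finset.range m)
    fun j _ => (hasSum_frobenius_choose p Y j).mul_left ((2 * t - 1) ^ j))
  change HasSum _ (frobeniusSeries p (Y * t) - _) at h1
  have h2 : ∀ k : ℕ, frobeniusCoeff p k * (Y * t) ^ k - ∑ j ∈ Finset.range m, (2 * t - 1) ^ j *
      (frobeniusCoeff p k * Y ^ k * (k.choose j * (1 / 2) ^ k)) =
      frobeniusCoeff p k * Y ^ k * (t ^ k - ∑ j ∈ Finset.range m, (2 * t - 1) ^ j *
        (k.choose j * (1 / 2) ^ k)) := by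
    intro k
    rw [mul_sub, Finset.mul_sum, mul_pow, mul_assoc]
    congr 1
    refine Finset.sum_congr rfl fun j _ => ?_
    ring
  rw [← h1.tsum_eq]
  refine abs_tsum_le_of_factorial_bound h1.summable (fun k hk => ?_) hC hY fun i => ?_
  · rw [h2, ← pow_eq_taylor_half t hk, sub_self, mul_zero]
  · rw [h2, abs_mul, abs_mul, abs_of_nonneg (a := Y ^ (m + i)) (by positivity)]
    calc |frobeniusCoeff p (m + i)| * Y ^ (m + i) * |t ^ (m + i) - ∑ j ∈ Finset.range m,
          (2 * t - 1) ^ j * ((m + i).choose j * (1 / 2) ^ (m + i))|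
        ≤ (C * ((4 / 3) ^ (m + i) / ((m + i).factorial : ℝ) ^ 2)) * Y ^ (m + i) *
          ((3 / 4) ^ m * (3 / 2) ^ i) := by
          gcongr
          · exact h _
          · exact abs_pow_sub_taylor_half_le ht0 ht1 m i
      _ = C * ((4 / 3 * (3 / 4)) ^ m * (4 / 3 * (3 / 2)) ^ i * Y ^ (m + i) *
          (1 / ((m + i).factorial : ℝ) ^ 2)) := by
          rw [mul_pow, mul_pow, pow_add]
          ring
      _ = _ := by norm_num

theorem abs_frobenius_sub_sum_le {p C Y t : ℝ} (hC : 0 ≤ C)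
    (h : ∀ k : ℕ, |frobeniusCoeff p k| ≤ C * (1 / (k.factorial : ℝ) ^ 2))
    (hY : 0 ≤ Y) (ht0 : 0 ≤ t) (ht1 : t ≤ 1) (m : ℕ) :
    |frobeniusSeries p (Y * t) - ∑ j ∈ Finset.range m, frobeniusCoeff p j * (Y * t) ^ j| ≤
      C * ((4 * Y) ^ m / ((2 * m).factorial : ℝ)) * Real.exp (√(8 * Y)) := by
  have hs := summable_frobenius p (Y * t)
  have h1 : frobeniusSeries p (Y * t) -
      ∑ j ∈ Finset.range m, frobeniusCoeff p j * (Y * t) ^ j =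
      ∑' k, if k < m then 0 else frobeniusCoeff p k * (Y * t) ^ k := by
    unfold frobeniusSeries
    rw [← hs.sum_add_tsum_nat_add m, add_sub_cancel_left]
    have hs' : Summable fun k => if k < m then 0 else frobeniusCoeff p k * (Y * t) ^ k := by
      rw [← summable_nat_add_iff m]
      simpa using (summable_nat_add_iff m).2 hs
    rw [← hs'.sum_add_tsum_nat_add m, Finset.sum_eq_zero, zero_add]
    · simp
    · intro k hk
      rw [if_pos (Finset.mem_range.1 hk)]
  rw [h1]
  refine abs_tsum_le_of_factorial_bound ?_ (fun k hk => if_pos hk) hC hY fun i => ?_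
  · rw [← summable_nat_add_iff m]
    simpa using (summable_nat_add_iff m).2 hs
  · rw [if_neg (by omega), abs_mul, abs_of_nonneg (a := (Y * t) ^ (m + i)) (by positivity)]
    have h2 : (1 : ℝ) ≤ 2 ^ i := one_le_pow₀ (by norm_num)
    have h3 : (Y * t) ^ (m + i) ≤ Y ^ (m + i) :=
      pow_le_pow_left₀ (by positivity) (mul_le_of_le_one_right hY ht1) _
    calc |frobeniusCoeff p (m + i)| * (Y * t) ^ (m + i)
        ≤ (C * (1 / ((m + i).factorial : ℝ) ^ 2)) * (2 ^ i * Y ^ (m + i)) := by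
          gcongr
          · exact h _
          · exact h3.trans (le_mul_of_one_le_left (by positivity) h2)
      _ = _ := by ring

/-! ### Separable approximation of `H_ν` and of the Matérn kernel. -/

theorem exists_separable_approx_besselH {ν : ℝ} (hν : 0 < ν) (hνℕ : ∀ n : ℕ, ν ≠ n) :
    ∃ K : ℝ, 0 < K ∧ ∀ m : ℕ, 0 < m → ∃ (F G : Fin m ⊕ Fin m → ℝ → ℝ) (i₀ : Fin m ⊕ Fin m),
      (∀ t, F i₀ t = 1) ∧ (∀ i, ∀ t ∈ Ioc (0 : ℝ) 1, |F i t| ≤ 1) ∧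
      (∀ i, Continuous (G i)) ∧ ∀ t ∈ Ioc (0 : ℝ) 1, ∀ Y : ℝ, 0 < Y →
        |besselH ν (Y * t) - ∑ i, F i t * G i Y| ≤
          K * (1 + Y ^ ν) * ((4 * Y) ^ m / ((2 * m).factorial : ℝ)) * Real.exp (√(8 * Y)) := by
  obtain ⟨α, β, hH⟩ := exists_besselH_eq hν hνℕ
  obtain ⟨C₁, hC₁, h₁⟩ := exists_abs_frobeniusCoeff_le (p := -ν) (q := 3 / 4) (by norm_num)
    (eventually_mul_succ_le _ (by norm_num))
  obtain ⟨C₂, hC₂, h₂⟩ := exists_abs_frobeniusCoeff_le (p := ν) (q := 1) (by norm_num)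
    (Eventually.of_forall fun k => by linarith)
  have h₁' : ∀ k : ℕ, |frobeniusCoeff (-ν) k| ≤ C₁ * ((4 / 3) ^ k / (k.factorial : ℝ) ^ 2) := by
    simpa using h₁
  have h₂' : ∀ k : ℕ, |frobeniusCoeff ν k| ≤ C₂ * (1 / (k.factorial : ℝ) ^ 2) := by
    simpa using h₂
  refine ⟨|α| * C₁ + |β| * C₂ + 1, by positivity, fun m hm => ?_⟩
  -- All constants go into the functions of `Y`, so that the functions of `t` are bounded by 1. The
  -- term `j = 0` of the midpoint expansion supplies the constant coefficient 1.
  refine ⟨Sum.elim (fun j t => (2 * t - 1) ^ (j : ℕ)) (fun j t => t ^ ν * t ^ (j : ℕ)),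
    Sum.elim (fun j Y => α * ((Y / 2) ^ (j : ℕ) / (j : ℕ).factorial *
        frobeniusSeries (-ν + (j : ℕ)) (Y / 2)))
      (fun j Y => β * (Y ^ ν * (frobeniusCoeff ν j * Y ^ (j : ℕ)))),
    Sum.inl ⟨0, hm⟩, fun t => by simp, ?_, ?_, ?_⟩
  · rintro (j | j) t ⟨ht0, ht1⟩
    · simp only [Sum.elim_inl, abs_pow]
      exact pow_le_one₀ (abs_nonneg _) (abs_le.2 ⟨by linarith, by linarith⟩)
    · simp only [Sum.elim_inr]
      rw [abs_of_nonneg (by positivity)]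
      exact mul_le_one₀ (Real.rpow_le_one ht0.le ht1 hν.le) (by positivity)
        (pow_le_one₀ ht0.le ht1)
  · rintro (j | j)
    · have : Continuous (frobeniusSeries (-ν + (j : ℕ))) :=
        continuous_iff_continuousAt.2 fun y => (hasDerivAt_frobenius _ y).continuousAt
      simp only [Sum.elim_inl]
      fun_prop
    · have : Continuous fun Y : ℝ => Y ^ ν := Real.continuous_rpow_const hν.le
      simp only [Sum.elim_inr]
      fun_prop
  · rintro t ⟨ht0, ht1⟩ Y hY
    have e1 := abs_frobenius_sub_taylor_le hC₁.le h₁' hY.le ht0.le ht1 m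
    have e2 := abs_frobenius_sub_sum_le hC₂.le h₂' hY.le ht0.le ht1 m
    set B := (4 * Y) ^ m / ((2 * m).factorial : ℝ)
    set X := Real.exp (√(8 * Y))
    have hB : 0 ≤ B := by positivity
    have hX : 0 ≤ X := (Real.exp_pos _).le
    have hYt : (Y * t) ^ ν ≤ Y ^ ν :=
      Real.rpow_le_rpow (by positivity) (mul_le_of_le_one_right hY.le ht1) hν.le
    rw [hH _ (by positivity), Fintype.sum_sum_type]
    simp only [Sum.elim_inl, Sum.elim_inr]
    rw [Fin.sum_univ_eq_sum_range (fun j => (2 * t - 1) ^ j * (α * ((Y / 2) ^ j / j.factorial *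
        frobeniusSeries (-ν + j) (Y / 2)))),
      Fin.sum_univ_eq_sum_range (fun j => t ^ ν * t ^ j * (β * (Y ^ ν *
        (frobeniusCoeff ν j * Y ^ j))))]
    have key : α * frobeniusSeries (-ν) (Y * t) + β * ((Y * t) ^ ν * frobeniusSeries ν (Y * t)) -
        (∑ j ∈ Finset.range m, (2 * t - 1) ^ j * (α * ((Y / 2) ^ j / j.factorial *
          frobeniusSeries (-ν + j) (Y / 2))) +
        ∑ j ∈ Finset.range m, t ^ ν * t ^ j * (β * (Y ^ ν * (frobeniusCoeff ν j * Y ^ j)))) =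
        α * (frobeniusSeries (-ν) (Y * t) - ∑ j ∈ Finset.range m, (2 * t - 1) ^ j *
          ((Y / 2) ^ j / j.factorial * frobeniusSeries (-ν + j) (Y / 2))) +
        β * ((Y * t) ^ ν * (frobeniusSeries ν (Y * t) -
          ∑ j ∈ Finset.range m, frobeniusCoeff ν j * (Y * t) ^ j)) := by
      have s1 : ∑ j ∈ Finset.range m, (2 * t - 1) ^ j * (α * ((Y / 2) ^ j / j.factorial *
          frobeniusSeries (-ν + j) (Y / 2))) = α * ∑ j ∈ Finset.range m, (2 * t - 1) ^ j *
          ((Y / 2) ^ j / j.factorial * frobeniusSeries (-ν + j) (Y / 2)) := by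
        rw [Finset.mul_sum]
        exact Finset.sum_congr rfl fun j _ => by ring
      have s2 : ∑ j ∈ Finset.range m, t ^ ν * t ^ j * (β * (Y ^ ν *
          (frobeniusCoeff ν j * Y ^ j))) = β * ((Y * t) ^ ν *
          ∑ j ∈ Finset.range m, frobeniusCoeff ν j * (Y * t) ^ j) := by
        rw [Finset.mul_sum, Finset.mul_sum, Real.mul_rpow hY.le ht0.le]
        exact Finset.sum_congr rfl fun j _ => by rw [mul_pow]; ring
      rw [s1, s2]
      ring
    rw [key]
    refine (abs_add_le _ _).trans ?_
    rw [abs_mul, abs_mul, abs_mul, abs_of_nonneg (a := (Y * t) ^ ν) (by positivity)]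
    calc _ ≤ |α| * (C₁ * B * X) + |β| * (Y ^ ν * (C₂ * B * X)) := by gcongr
      _ = (|α| * C₁ + |β| * C₂ * Y ^ ν) * (B * X) := by ring
      _ ≤ ((|α| * C₁ + |β| * C₂ + 1) * (1 + Y ^ ν)) * (B * X) := by
          gcongr
          have : 0 ≤ |α| * C₁ * Y ^ ν := by positivity
          have : 0 ≤ |β| * C₂ := by positivity
          have : 0 ≤ Y ^ ν := by positivity
          nlinarith
      _ = _ := by ring

theorem maternKernel_eq_sq_mul (ν ℓ σ z : ℝ) :
    maternKernel ν ℓ σ z = σ ^ 2 * maternKernel ν ℓ 1 z := by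
  unfold maternKernel
  split_ifs <;> ring

/-- Separable approximation of the Matérn kernel of unit variance, uniformly in the length scale
`ℓ ≥ ℓmin` and in the distance `0 < z ≤ δ`. -/
theorem exists_separable_approx_maternKernel {ν : ℝ} (hν : 0 < ν) (hνℕ : ∀ n : ℕ, ν ≠ n) :
    ∃ K : ℝ, 0 < K ∧ ∀ m : ℕ, 0 < m → ∀ ℓmin : ℝ, 0 < ℓmin →
      ∃ (F G : Fin m ⊕ Fin m → ℝ → ℝ) (i₀ : Fin m ⊕ Fin m),
      (∀ ℓ, F i₀ ℓ = 1) ∧ (∀ i ℓ, ℓmin ≤ ℓ → |F i ℓ| ≤ 1) ∧ (∀ i, Continuous (G i)) ∧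
      ∀ ℓ δ z : ℝ, ℓmin ≤ ℓ → 0 < z → z ≤ δ →
        |maternKernel ν ℓ 1 z - ∑ i, F i ℓ * G i z| ≤
          K * (1 + (δ / ℓmin) ^ (2 * ν)) * Real.exp ((δ / ℓmin) ^ 2 / 4) *
            ((√(2 * ν) * (δ / ℓmin)) ^ (2 * m) / ((2 * m).factorial : ℝ)) := by
  obtain ⟨K, hK, h⟩ := exists_separable_approx_besselH hν hνℕ
  have hΓ := Real.Gamma_pos_of_pos hν
  -- `(ν/2)^ν` comes from `Y ≤ (ν/2) ζ²`, and `exp(4ν)` from the bound on `exp √(8Y)` below.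
  refine ⟨1 / Real.Gamma ν * K * (1 + (ν / 2) ^ ν) * Real.exp (4 * ν), by positivity,
    fun m hm ℓmin hℓmin => ?_⟩
  obtain ⟨F, G, i₀, hF0, hF1, hG, hb⟩ := h m hm
  have ht : ∀ ℓ, ℓmin ≤ ℓ → (ℓmin / ℓ) ^ 2 ∈ Ioc (0 : ℝ) 1 := fun ℓ hℓ => by
    have : 0 < ℓ := hℓmin.trans_le hℓ
    exact ⟨by positivity, pow_le_one₀ (by positivity) ((div_le_one this).2 hℓ)⟩
  refine ⟨fun i ℓ => F i ((ℓmin / ℓ) ^ 2),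
    fun i z => 1 / Real.Gamma ν * G i (ν * z ^ 2 / (2 * ℓmin ^ 2)), i₀, fun ℓ => hF0 _,
    fun i ℓ hℓ => hF1 i _ (ht ℓ hℓ), fun i => ?_, fun ℓ δ z hℓ hz hzδ => ?_⟩
  · have := hG i
    fun_prop
  have hℓ0 : 0 < ℓ := hℓmin.trans_le hℓ
  set ζ := δ / ℓmin with hζ
  have hδ : 0 < δ := hz.trans_le hzδ
  have hζ0 : 0 < ζ := by positivity
  set Y := ν * z ^ 2 / (2 * ℓmin ^ 2) with hY
  have hY0 : 0 < Y := by positivity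
  have hYle : Y ≤ ν / 2 * ζ ^ 2 := by
    have : Y = ν / 2 * (z / ℓmin) ^ 2 := by rw [hY]; field_simp
    rw [this, hζ]
    gcongr
  have harg : ν * z ^ 2 / (2 * ℓ ^ 2) = Y * (ℓmin / ℓ) ^ 2 := by
    rw [hY]; field_simp
  have hsum : ∑ i, F i ((ℓmin / ℓ) ^ 2) * (1 / Real.Gamma ν * G i Y) =
      1 / Real.Gamma ν * ∑ i, F i ((ℓmin / ℓ) ^ 2) * G i Y := by
    rw [Finset.mul_sum]
    exact Finset.sum_congr rfl fun i _ => by ring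
  rw [maternKernel_eq_besselH 1 hν hℓ0 hz, harg, hsum, one_pow, ← mul_sub, abs_mul,
    abs_of_pos (a := 1 / Real.Gamma ν) (by positivity)]
  have b1 : Y ^ ν ≤ (ν / 2) ^ ν * ζ ^ (2 * ν) := by
    calc Y ^ ν ≤ (ν / 2 * ζ ^ 2) ^ ν := Real.rpow_le_rpow hY0.le hYle hν.le
      _ = _ := by
        rw [Real.mul_rpow (by positivity) (by positivity), ← Real.rpow_natCast, ← Real.rpow_mul
          hζ0.le]
        norm_num
  have b2 : (4 * Y) ^ m ≤ (√(2 * ν) * ζ) ^ (2 * m) := by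
    rw [pow_mul, mul_pow (√(2 * ν)), Real.sq_sqrt (by positivity)]
    refine pow_le_pow_left₀ (by positivity) ?_ _
    linarith
  -- AM-GM: `8Y ≤ 4ν ζ² ≤ (4ν + ζ²/4)²`.
  have b3 : Real.exp (√(8 * Y)) ≤ Real.exp (4 * ν) * Real.exp (ζ ^ 2 / 4) := by
    rw [← Real.exp_add]
    refine Real.exp_le_exp.2 (Real.sqrt_le_iff.2 ⟨by positivity, ?_⟩)
    nlinarith [sq_nonneg (4 * ν - ζ ^ 2 / 4)]
  have hζν : 0 ≤ ζ ^ (2 * ν) := by positivity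
  have hνν : 0 ≤ (ν / 2) ^ ν := by positivity
  have b4 : 1 + Y ^ ν ≤ (1 + (ν / 2) ^ ν) * (1 + ζ ^ (2 * ν)) := by nlinarith
  calc _ ≤ 1 / Real.Gamma ν * (K * (1 + Y ^ ν) * ((4 * Y) ^ m / ((2 * m).factorial : ℝ)) *
        Real.exp (√(8 * Y))) := by
        gcongr
        exact hb _ (ht ℓ hℓ) Y hY0
    _ ≤ 1 / Real.Gamma ν * (K * ((1 + (ν / 2) ^ ν) * (1 + ζ ^ (2 * ν))) *
        ((√(2 * ν) * ζ) ^ (2 * m) / ((2 * m).factorial : ℝ)) *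
        (Real.exp (4 * ν) * Real.exp (ζ ^ 2 / 4))) := by gcongr
    _ = _ := by ring

/-! ### From self-adjoint to positive finite rank approximations. -/

section FiniteRank

variable {H : Type*} [NormedAddCommGroup H] [InnerProductSpace ℝ H]

/-- `T` is a norm limit of operators with finite-dimensional range. -/
def IsFiniteDimApproximable (T : H →L[ℝ] H) : Prop :=
  ∀ η : ℝ, 0 < η → ∃ V : Submodule ℝ H, FiniteDimensional ℝ V ∧
    ∀ x, ∃ v ∈ V, ‖T x - v‖ ≤ η * ‖x‖

/-- In an orthonormal basis `b` of `V`, `T x = ∑ ⟪b i, T x⟫ b i = ∑ ⟪T (b i), x⟫ b i`; padding by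
zeros makes this finite sum a nuclear representation. -/
theorem isTraceClass_of_starProjection_comp [CompleteSpace H] {V : Submodule ℝ H}
    [FiniteDimensional ℝ V] {T : H →L[ℝ] H} (hT : IsSelfAdjoint T)
    (h : ∀ x, V.starProjection (T x) = T x) : IsTraceClass T := by
  set n := Module.finrank ℝ V
  let b := stdOrthonormalBasis ℝ V
  have hsym := (ContinuousLinearMap.isSelfAdjoint_iff_isSymmetric.1 hT)
  refine ⟨fun k => if hk : k < n then T (b ⟨k, hk⟩) else 0,
    fun k => if hk : k < n then (b ⟨k, hk⟩ : H) else 0, ?_, fun x => ?_⟩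
  · refine summable_of_ne_finset_zero (s := Finset.range n) fun k hk => ?_
    have hk : ¬k < n := by simpa using hk
    simp [hk]
  · have h1 : T x = ∑ i : Fin n, (inner ℝ (T (b i)) x : ℝ) • (b i : H) := by
      rw [← h x, b.starProjection_eq_sum_rankOne]
      simp only [sum_apply, InnerProductSpace.rankOne_apply]
      refine Finset.sum_congr rfl fun i _ => ?_
      rw [← ContinuousLinearMap.coe_coe T, hsym]
    have h2 : T x = ∑ k ∈ Finset.range n,
        (inner ℝ (if hk : k < n then T (b ⟨k, hk⟩) else 0) x : ℝ) •
          (if hk : k < n then (b ⟨k, hk⟩ : H) else 0) := by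
      rw [h1, Finset.sum_range]
      refine Finset.sum_congr rfl fun i _ => ?_
      simp
    rw [h2]
    refine hasSum_sum_of_ne_finset_zero fun k hk => ?_
    have hk : ¬k < n := by simpa using hk
    simp [hk]

/-- Best approximation bounds `P T - T` by `η`, taking adjoints bounds `T P - T`, and `P T P - T = P
(T P - T) + (P T - T)`. -/
theorem norm_sub_starProjection_comp_comp_le [CompleteSpace H] {V : Submodule ℝ H}
    [FiniteDimensional ℝ V] {T : H →L[ℝ] H} (hT : IsSelfAdjoint T) {η : ℝ} (hη : 0 ≤ η)
    (h : ∀ x, ∃ v ∈ V, ‖T x - v‖ ≤ η * ‖x‖) :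
    ‖V.starProjection ∘L T ∘L V.starProjection - T‖ ≤ 2 * η := by
  set P := V.starProjection with hP
  have hPsa : IsSelfAdjoint P := isSelfAdjoint_starProjection V
  have h1 : ‖P ∘L T - T‖ ≤ η := by
    refine ContinuousLinearMap.opNorm_le_bound _ hη fun x => ?_
    obtain ⟨v, hv, hvx⟩ := h x
    refine le_trans ?_ hvx
    rw [sub_apply, ContinuousLinearMap.comp_apply, norm_sub_rev, hP,
      Submodule.starProjection_minimal]
    exact ciInf_le ⟨0, by rintro _ ⟨w, rfl⟩; exact norm_nonneg _⟩ (⟨v, hv⟩ : V)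
  have h2 : ‖T ∘L P - T‖ ≤ η := by
    have : T ∘L P - T = ContinuousLinearMap.adjoint (P ∘L T - T) := by
      rw [map_sub, ContinuousLinearMap.adjoint_comp, hT.adjoint_eq, hPsa.adjoint_eq]
    rw [this, LinearIsometryEquiv.norm_map]
    exact h1
  have h3 : P ∘L T ∘L P - T = P ∘L (T ∘L P - T) + (P ∘L T - T) := by
    rw [ContinuousLinearMap.comp_sub]; abel
  rw [h3]
  calc ‖P ∘L (T ∘L P - T) + (P ∘L T - T)‖
      ≤ ‖P‖ * ‖T ∘L P - T‖ + ‖P ∘L T - T‖ :=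
        (norm_add_le _ _).trans (by gcongr; exact ContinuousLinearMap.opNorm_comp_le _ _)
    _ ≤ 1 * η + η := by
        gcongr
        exact V.starProjection_norm_le
    _ = 2 * η := by ring

/-- A separable approximation of a family of positive operators by self-adjoint operators can be
turned into one by positive finite rank operators, with the same coefficients, if one of the
coefficients is the constant `1`. -/
theorem exists_separable_positive_approx [CompleteSpace H] {ι R : Type*} [Fintype ι]
    {T : ι → H →L[ℝ] H} (hsa : ∀ i, IsSelfAdjoint (T i))
    (hap : ∀ i, IsFiniteDimApproximable (T i)) {F : ι → R → ℝ} {i₀ : ι} {S : Set R}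
    (hF0 : ∀ r, F i₀ r = 1) (hF1 : ∀ i, ∀ r ∈ S, |F i r| ≤ 1) {C : R → H →L[ℝ] H}
    (hC : ∀ r ∈ S, (C r).IsPositive) {ε : ℝ} (hε : 0 < ε)
    (hle : ∀ r ∈ S, ‖∑ i, F i r • T i - C r‖ ≤ ε) :
    ∃ T' : ι → H →L[ℝ] H, ∀ r ∈ S, ∑ i, F i r • T' i ∈ covarianceOperators H ∧
      ‖∑ i, F i r • T' i - C r‖ ≤ 3 * ε := by
  classical
  -- Each compressed operator moves by at most `2η`, so all of them together by at most `ε`.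
  set η := ε / (2 * (Fintype.card ι + 1)) with hη
  have hη0 : 0 < η := by positivity
  choose W hWfd hW using fun i => hap i η hη0
  set V : Submodule ℝ H := ⨆ i, W i
  have : FiniteDimensional ℝ V := Submodule.finiteDimensional_iSup W
  have hV : ∀ i x, ∃ v ∈ V, ‖T i x - v‖ ≤ η * ‖x‖ := fun i x => by
    obtain ⟨v, hv, hvx⟩ := hW i x
    exact ⟨v, le_iSup W i hv, hvx⟩
  set P := V.starProjection with hP
  have hPsa : IsSelfAdjoint P := isSelfAdjoint_starProjection V
  have hPsym := ContinuousLinearMap.isSelfAdjoint_iff_isSymmetric.1 hPsa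
  have hPP : ∀ x, P (P x) = P x := fun x =>
    Submodule.starProjection_eq_self_iff.2 (Submodule.starProjection_apply_mem V x)
  -- Since `F i₀ = 1`, the sum becomes `P A P + ε P`: the shift does not depend on the parameter and
  -- needs no extra term.
  refine ⟨fun i => P ∘L T i ∘L P + if i = i₀ then ε • P else 0, fun r hr => ?_⟩
  set A := ∑ i, F i r • T i with hA
  have hB : ∑ i, F i r • (P ∘L T i ∘L P + if i = i₀ then ε • P else 0) =
      P ∘L A ∘L P + ε • P := by
    simp only [smul_add, Finset.sum_add_distrib, smul_ite, smul_zero, Finset.sum_ite_eq',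
      Finset.mem_univ, if_true, hF0, one_smul]
    congr 1
    ext x
    simp [hA, map_sum]
  rw [hB]
  have hAsa : IsSelfAdjoint A := by
    rw [hA]
    refine isSelfAdjoint_sum _ fun i _ => ?_
    exact (IsSelfAdjoint.all (F i r)).smul (hsa i)
  have hBsa : IsSelfAdjoint (P ∘L A ∘L P + ε • P) := by
    refine IsSelfAdjoint.add ?_ ((IsSelfAdjoint.all ε).smul hPsa)
    have := hAsa.conj_adjoint P
    rwa [hPsa.adjoint_eq] at this
  refine ⟨⟨?_, ?_⟩, ?_⟩
  · rw [ContinuousLinearMap.isPositive_iff]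
    refine ⟨ContinuousLinearMap.isSelfAdjoint_iff_isSymmetric.1 hBsa, fun x => ?_⟩
    have h1 : inner ℝ ((P ∘L A ∘L P + ε • P) x) x =
        inner ℝ (A (P x)) (P x) + ε * ‖P x‖ ^ 2 := by
      simp only [add_apply, ContinuousLinearMap.comp_apply,
        smul_apply, inner_add_left, inner_smul_left]
      have e1 : inner ℝ (P (A (P x))) x = inner ℝ (A (P x)) (P x) := hPsym _ _
      have e2 : inner ℝ (P x) x = inner ℝ (P x) (P x) := by
        conv_lhs => rw [← hPP x]
        exact hPsym _ _
      rw [e1, e2, real_inner_self_eq_norm_sq]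
      simp
    rw [h1]
    -- `A` is within `ε` of the positive operator `C r`, so its quadratic form at `P x` is at least
    -- `-ε ‖P x‖²`, which the shift compensates.
    have h2 := ((ContinuousLinearMap.isPositive_iff _).1 (hC r hr)).2 (P x)
    have h3 : |inner ℝ ((A - C r) (P x)) (P x)| ≤ ε * ‖P x‖ ^ 2 := by
      refine (abs_real_inner_le_norm _ _).trans ?_
      rw [pow_two, ← mul_assoc]
      gcongr
      exact (A - C r).le_of_opNorm_le (hle r hr) _
    rw [sub_apply, inner_sub_left] at h3
    linarith [(abs_le.1 h3).1]
  · refine isTraceClass_of_starProjection_comp (V := V) hBsa fun x => ?_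
    simp only [add_apply, ContinuousLinearMap.comp_apply,
      smul_apply, map_add, map_smul]
    rw [← hP, hPP, hPP]
  · have h1 : P ∘L A ∘L P - A = ∑ i, F i r • (P ∘L T i ∘L P - T i) := by
      simp only [smul_sub, Finset.sum_sub_distrib]
      congr 1
      ext x
      simp [hA, map_sum]
    have h2 : ‖P ∘L A ∘L P - A‖ ≤ ε := by
      rw [h1]
      calc ‖∑ i, F i r • (P ∘L T i ∘L P - T i)‖
          ≤ ∑ i : ι, 2 * η := by
            refine norm_sum_le_of_le _ fun i _ => ?_
            rw [norm_smul, Real.norm_eq_abs]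
            calc |F i r| * ‖P ∘L T i ∘L P - T i‖ ≤ 1 * (2 * η) := by
                  gcongr
                  · exact hF1 i r hr
                  · exact norm_sub_starProjection_comp_comp_le (hsa i) hη0.le (hV i)
              _ = 2 * η := one_mul _
        _ = Fintype.card ι * (2 * η) := by simp
        _ ≤ ε := by
            rw [hη]
            have : (0 : ℝ) ≤ Fintype.card ι := Nat.cast_nonneg _
            field_simp
            linarith
    have h3 : ‖ε • P‖ ≤ ε := by
      rw [norm_smul, Real.norm_of_nonneg hε.le]
      exact mul_le_of_le_one_right hε.le V.starProjection_norm_le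
    have h4 : P ∘L A ∘L P + ε • P - C r = (P ∘L A ∘L P - A) + ε • P + (A - C r) := by abel
    rw [h4]
    calc _ ≤ ‖P ∘L A ∘L P - A‖ + ‖ε • P‖ + ‖A - C r‖ := norm_add₃_le
      _ ≤ ε + ε + ε := by gcongr; exact hle r hr
      _ = 3 * ε := by ring

theorem smul_mem_covarianceOperators {T : H →L[ℝ] H} (hT : T ∈ covarianceOperators H) {c : ℝ}
    (hc : 0 ≤ c) : c • T ∈ covarianceOperators H := by
  obtain ⟨hpos, a, b, hs, hsum⟩ := hT
  refine ⟨?_, a, fun n => c • b n, ?_, fun x => ?_⟩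
  · rw [ContinuousLinearMap.isPositive_iff] at hpos ⊢
    refine ⟨fun x y => ?_, fun x => ?_⟩
    · have := hpos.1 x y
      simp only [ContinuousLinearMap.coe_coe, smul_apply, inner_smul_left,
        inner_smul_right] at this ⊢
      rw [this]
      simp
    · rw [smul_apply, inner_smul_left]
      exact mul_nonneg (by simpa using hc) (hpos.2 x)
  · refine (hs.mul_left ‖c‖).congr fun n => ?_
    rw [norm_smul]
    ring
  · refine ((hsum x).const_smul c).congr_fun fun n => ?_
    exact smul_comm _ _ _

end FiniteRank

/-! ### Integral operators on `L²(D)`: norm bounds and self-adjointness. -/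

section Kernel

variable {d : ℕ} {D : Set (EuclideanSpace ℝ (Fin d))}

theorem isFiniteMeasure_restrict_of_isBounded (hD : Bornology.IsBounded D) :
    IsFiniteMeasure (volume.restrict D) :=
  ⟨by rw [Measure.restrict_apply_univ]; exact hD.measure_lt_top⟩

theorem integrable_L2 (hD : Bornology.IsBounded D) (φ : L2 D) :
    Integrable (fun x => φ x) (volume.restrict D) := by
  have := isFiniteMeasure_restrict_of_isBounded hD
  exact (Lp.memLp φ).integrable (by norm_num)

theorem integral_norm_le_L2 (hD : Bornology.IsBounded D) (φ : L2 D) :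
    ∫ x in D, ‖φ x‖ ≤ (volume.real D) ^ (1 / 2 : ℝ) * ‖φ‖ := by
  have := isFiniteMeasure_restrict_of_isBounded hD
  have h := integral_mul_norm_le_Lp_mul_Lq (μ := volume.restrict D) (f := fun _ => (1 : ℝ))
    (g := fun x => φ x) (p := 2) (q := 2) Real.HolderConjugate.two_two (memLp_const 1)
    (by simpa using Lp.memLp φ)
  have hn : ‖φ‖ = (∫ x in D, ‖φ x‖ ^ (2 : ℝ)) ^ (1 / 2 : ℝ) := by
    rw [Lp.norm_def, (Lp.memLp φ).eLpNorm_eq_integral_rpow_norm (by norm_num) (by norm_num),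
      ENNReal.toReal_ofReal (by positivity)]
    simp
  rw [hn]
  simpa using h

/-- Passing from the supremum to `L²` and from `L¹` to `L²` costs a factor `Leb(D)^(1/2)` each. -/
theorem norm_le_of_ae_le_integral_norm (hD : Bornology.IsBounded D) {f φ : L2 D} {M : ℝ}
    (hM : 0 ≤ M) (h : ∀ᵐ y ∂volume.restrict D, ‖f y‖ ≤ M * ∫ x in D, ‖φ x‖) :
    ‖f‖ ≤ M * volume.real D * ‖φ‖ := by
  have := isFiniteMeasure_restrict_of_isBounded hD
  have h1 := Lp.norm_le_of_ae_bound (p := 2) (by positivity) h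
  have h2 : (measureUnivNNReal (volume.restrict D) : ℝ) = volume.real D := by
    simp only [measureUnivNNReal, measureReal_def, Measure.restrict_apply_univ]
    rfl
  have h3 : ((volume.real D) ^ (1 / 2 : ℝ)) * (volume.real D) ^ (1 / 2 : ℝ) = volume.real D := by
    rw [← Real.rpow_add_of_nonneg measureReal_nonneg (by norm_num) (by norm_num)]
    norm_num
  calc ‖f‖ ≤ (volume.real D) ^ (1 / 2 : ℝ) * (M * ∫ x in D, ‖φ x‖) := by
        simpa [h2] using h1
    _ ≤ (volume.real D) ^ (1 / 2 : ℝ) * (M * ((volume.real D) ^ (1 / 2 : ℝ) * ‖φ‖)) := by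
        gcongr
        exact integral_norm_le_L2 hD φ
    _ = M * (((volume.real D) ^ (1 / 2 : ℝ)) * (volume.real D) ^ (1 / 2 : ℝ)) * ‖φ‖ := by ring
    _ = _ := by rw [h3]

theorem integrable_mul_kernel (hD : Bornology.IsBounded D)
    {k : EuclideanSpace ℝ (Fin d) → EuclideanSpace ℝ (Fin d) → ℝ}
    (hk : Measurable (Function.uncurry k)) {M : ℝ} (hM : ∀ x y, |k x y| ≤ M) (φ : L2 D)
    (y : EuclideanSpace ℝ (Fin d)) :
    Integrable (fun x => φ x * k x y) (volume.restrict D) :=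
  (integrable_L2 hD φ).mul_bdd (c := M)
    (hk.comp (measurable_id.prodMk measurable_const)).aestronglyMeasurable
    (Eventually.of_forall fun x => by simpa using hM x y)

/-- The operator on the left has the difference of the kernels as its kernel. The diagonal may be
ignored because points are null sets for `d ≥ 1`. -/
theorem norm_sum_smul_sub_le (hd : 1 ≤ d) (hDm : MeasurableSet D) (hD : Bornology.IsBounded D)
    {ι : Type*} [Fintype ι] {k : ι → EuclideanSpace ℝ (Fin d) → EuclideanSpace ℝ (Fin d) → ℝ}
    (hk : ∀ i, Measurable (Function.uncurry (k i))) {M : ι → ℝ} (hM : ∀ i x y, |k i x y| ≤ M i)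
    {T : ι → L2 D →L[ℝ] L2 D} (hT : ∀ i, HasKernel (T i) (k i))
    {k' : EuclideanSpace ℝ (Fin d) → EuclideanSpace ℝ (Fin d) → ℝ}
    (hk' : Measurable (Function.uncurry k')) {M' : ℝ} (hM' : ∀ x y, |k' x y| ≤ M')
    {T' : L2 D →L[ℝ] L2 D} (hT' : HasKernel T' k') (c : ι → ℝ) {B : ℝ} (hB : 0 ≤ B)
    (h : ∀ x ∈ D, ∀ y ∈ D, x ≠ y → |k' x y - ∑ i, c i * k i x y| ≤ B) :
    ‖∑ i, c i • T i - T'‖ ≤ B * volume.real D := by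
  have : Nonempty (Fin d) := ⟨⟨0, hd⟩⟩
  refine ContinuousLinearMap.opNorm_le_bound _ (by positivity) fun φ => ?_
  refine norm_le_of_ae_le_integral_norm hD hB ?_
  have e0 : (∑ i, c i • T i - T') φ = (∑ i, c i • T i φ) - T' φ := by
    simp [sum_apply]
  rw [e0]
  have e3 : ∀ᵐ y ∂volume.restrict D, ∀ i, T i φ y = ∫ x in D, φ x * k i x y :=
    ae_all_iff.2 fun i => hT i φ
  have e4 : ∀ᵐ y ∂volume.restrict D, ∀ i, (c i • T i φ : L2 D) y = c i * T i φ y :=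
    ae_all_iff.2 fun i => Lp.coeFn_smul (c i) (T i φ)
  filter_upwards [Lp.coeFn_sub (∑ i, c i • T i φ) (T' φ),
    Lp.coeFn_finsetSum Finset.univ fun i => c i • T i φ, e3, e4, hT' φ,
    ae_restrict_mem hDm] with y h1 h2 h3 h4 h5 hy
  rw [h1, Pi.sub_apply, h2, Finset.sum_apply, h5]
  simp only [h4, h3]
  have hi := fun i => integrable_mul_kernel hD (hk i) (hM i) φ y
  have h6 : ∑ i, c i * ∫ x in D, φ x * k i x y = ∫ x in D, ∑ i, c i * (φ x * k i x y) := by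
    rw [integral_finsetSum _ fun i _ => (hi i).const_mul _]
    exact Finset.sum_congr rfl fun i _ => (integral_const_mul _ _).symm
  rw [h6, ← integral_sub (integrable_finsetSum _ fun i _ => (hi i).const_mul _)
    (integrable_mul_kernel hD hk' hM' φ y), ← integral_const_mul]
  refine norm_integral_le_of_norm_le ((integrable_L2 hD φ).norm.const_mul B) ?_
  have hne : ∀ᵐ x ∂volume.restrict D, x ≠ y := by
    refine ae_restrict_of_ae ?_
    exact Measure.ae_ne volume y
  filter_upwards [ae_restrict_mem hDm, hne] with x hx hxy
  have h7 : ∑ i, c i * (φ x * k i x y) - φ x * k' x y =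
      -((k' x y - ∑ i, c i * k i x y) * φ x) := by
    rw [sub_mul, Finset.sum_mul, neg_sub]
    congr 1
    · exact Finset.sum_congr rfl fun i _ => by ring
    · ring
  rw [h7, norm_neg, norm_mul]
  gcongr
  exact h x hx y hy hxy

theorem isSelfAdjoint_of_hasKernel (hD : Bornology.IsBounded D)
    {k : EuclideanSpace ℝ (Fin d) → EuclideanSpace ℝ (Fin d) → ℝ}
    (hk : Measurable (Function.uncurry k)) {M : ℝ} (hM : ∀ x y, |k x y| ≤ M)
    (hsym : ∀ x y, k x y = k y x) {T : L2 D →L[ℝ] L2 D} (hT : HasKernel T k) :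
    IsSelfAdjoint T := by
  have := isFiniteMeasure_restrict_of_isBounded hD
  rw [ContinuousLinearMap.isSelfAdjoint_iff_isSymmetric]
  intro φ ψ
  rw [ContinuousLinearMap.coe_coe, L2.inner_def, L2.inner_def]
  have e1 : ∫ y in D, inner ℝ (T φ y) (ψ y) = ∫ y in D, ∫ x in D, ψ y * φ x * k x y := by
    refine integral_congr_ae ?_
    filter_upwards [hT φ] with y hy
    rw [hy, real_inner_comm, real_inner_eq_re_inner, RCLike.inner_apply]
    simp only [conj_trivial, RCLike.re_to_real]
    rw [mul_comm, ← integral_const_mul]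
    simp only [mul_assoc]
  have e2 : ∫ y in D, inner ℝ (φ y) (T ψ y) = ∫ y in D, ∫ x in D, ψ x * φ y * k y x := by
    refine integral_congr_ae ?_
    filter_upwards [hT ψ] with y hy
    rw [hy, real_inner_eq_re_inner, RCLike.inner_apply]
    simp only [conj_trivial, RCLike.re_to_real]
    rw [mul_comm, ← integral_const_mul]
    refine integral_congr_ae (Eventually.of_forall fun x => ?_)
    simp only [hsym x y]
    ring
  refine e1.trans (Eq.trans ?_ e2.symm)
  refine integral_integral_swap ?_
  have h1 := (integrable_L2 hD ψ).mul_prod (integrable_L2 hD φ)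
  exact h1.mul_bdd (c := M) (hk.comp measurable_swap).aestronglyMeasurable
    (Eventually.of_forall fun x => by simpa using hM _ _)

end Kernel

/-! ### Finite-dimensional approximation for uniformly continuous kernels. -/

section Approximable

variable {d : ℕ} {D : Set (EuclideanSpace ℝ (Fin d))}

/-- Finitely many balls about points of a dense sequence cover the compact closure of `D`; a
measurable nearest-point index then partitions `D` into small cells. -/
theorem exists_simpleFunc_dist_lt (hD : Bornology.IsBounded D) {r : ℝ} (hr : 0 < r) :
    ∃ (N : ℕ) (π : SimpleFunc (EuclideanSpace ℝ (Fin d)) ℕ) (e : ℕ → EuclideanSpace ℝ (Fin d)),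
      (∀ y, π y < N) ∧ ∀ y ∈ D, dist y (e (π y)) < r := by
  set e := TopologicalSpace.denseSeq (EuclideanSpace ℝ (Fin d))
  obtain ⟨N, hN⟩ : ∃ N : ℕ, closure D ⊆ ⋃ n ≤ N, Metric.ball (e n) r := by
    refine hD.isCompact_closure.elim_directed_cover (fun N : ℕ => ⋃ n ≤ N, Metric.ball (e n) r)
      (fun N => isOpen_biUnion fun n _ => Metric.isOpen_ball) (fun y _ => ?_) ?_
    · obtain ⟨n, hn⟩ := (TopologicalSpace.denseRange_denseSeq _).exists_dist_lt y hr
      exact mem_iUnion.2 ⟨n, mem_biUnion (le_refl n) hn⟩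
    · refine directed_of_isDirected_le fun a b hab => ?_
      exact biUnion_subset_biUnion_left fun n hn => le_trans hn hab
  refine ⟨N + 1, SimpleFunc.nearestPtInd e N, e,
    fun y => Nat.lt_succ_of_le (SimpleFunc.nearestPtInd_le e N y), fun y hy => ?_⟩
  obtain ⟨n, hn, hyn⟩ := mem_iUnion₂.1 (hN (subset_closure hy))
  have h1 := SimpleFunc.edist_nearestPt_le e y hn
  rw [edist_dist, edist_dist, ENNReal.ofReal_le_ofReal_iff dist_nonneg] at h1
  rw [dist_comm]
  refine lt_of_le_of_lt h1 ?_
  rw [dist_comm]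
  exact hyn

/-- Replacing `y` by the representative of its cell changes the kernel by at most `η'` and makes the
image a step function with `N` values. -/
theorem isFiniteDimApproximable_of_hasKernel (hDm : MeasurableSet D)
    (hD : Bornology.IsBounded D)
    {k : EuclideanSpace ℝ (Fin d) → EuclideanSpace ℝ (Fin d) → ℝ}
    (hk : UniformContinuous (Function.uncurry k)) {M : ℝ} (hM : ∀ x y, |k x y| ≤ M)
    {T : L2 D →L[ℝ] L2 D} (hT : HasKernel T k) : IsFiniteDimApproximable T := by
  have := isFiniteMeasure_restrict_of_isBounded hD
  intro η hη
  set η' := η / (volume.real D + 1)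
  have hvol : 0 ≤ volume.real D := measureReal_nonneg
  have hη' : 0 < η' := by positivity
  obtain ⟨r, hr, hkr⟩ := Metric.uniformContinuous_iff.1 hk η' hη'
  obtain ⟨N, π, e, hπN, hπ⟩ := exists_simpleFunc_dist_lt hD hr
  have hmem : ∀ c : Fin N → ℝ, MemLp (fun y => c ⟨π y, hπN y⟩) 2 (volume.restrict D) := by
    intro c
    have hm : Measurable fun y => c ⟨π y, hπN y⟩ := by
      have h1 : (fun y => c ⟨π y, hπN y⟩) = (fun n => if h : n < N then c ⟨n, h⟩ else 0) ∘ π := by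
        funext y
        simp [hπN y]
      rw [h1]
      exact measurable_from_top.comp π.measurable
    exact MemLp.of_bound hm.aestronglyMeasurable ‖c‖
      (Eventually.of_forall fun y => norm_le_pi_norm c _)
  let L : (Fin N → ℝ) →ₗ[ℝ] L2 D :=
    { toFun := fun c => (hmem c).toLp _
      map_add' := fun c c' => by rw [← MemLp.toLp_add]; rfl
      map_smul' := fun a c => by rw [RingHom.id_apply, ← MemLp.toLp_const_smul]; rfl }
  refine ⟨LinearMap.range L, inferInstance, fun φ => ?_⟩
  refine ⟨L fun i => ∫ x in D, φ x * k x (e i), ⟨_, rfl⟩, ?_⟩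
  have hle : η' * volume.real D ≤ η := by
    rw [div_mul_eq_mul_div, div_le_iff₀ (by positivity)]
    nlinarith
  refine (norm_le_of_ae_le_integral_norm hD hη'.le ?_).trans
    (mul_le_mul_of_nonneg_right hle (norm_nonneg _))
  filter_upwards [Lp.coeFn_sub (T φ) (L fun i => ∫ x in D, φ x * k x (e i)), hT φ,
    (hmem fun i => ∫ x in D, φ x * k x (e i)).coeFn_toLp, ae_restrict_mem hDm] with y h1 h2 h3 hy
  have h3' : L (fun i => ∫ x in D, φ x * k x (e i)) y = ∫ x in D, φ x * k x (e (π y)) := h3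
  have hkm : Measurable (Function.uncurry k) := hk.continuous.measurable
  rw [h1, Pi.sub_apply, h2, h3', ← integral_sub (integrable_mul_kernel hD hkm hM φ y)
    (integrable_mul_kernel hD hkm hM φ _), ← integral_const_mul]
  refine norm_integral_le_of_norm_le ((integrable_L2 hD φ).norm.const_mul η')
    (Eventually.of_forall fun x => ?_)
  rw [← mul_sub, norm_mul, mul_comm]
  gcongr
  have h4 : dist (x, y) (x, e (π y)) < r := by
    rw [Prod.dist_eq, dist_self]
    exact max_lt hr (hπ y hy)
  have h5 := hkr h4
  rw [Real.dist_eq] at h5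
  exact h5.le

end Approximable

/-! ### Positivity of the Matérn operator. -/

section PositiveDefinite

variable {d : ℕ} {D : Set (EuclideanSpace ℝ (Fin d))}

/-- A kernel that is a mixture of the positive semidefinite kernels `cos (θ x - θ y)` is positive
semidefinite. -/
theorem isPositive_of_hasKernel_cos (hd : 1 ≤ d) (hD : Bornology.IsBounded D)
    {k : EuclideanSpace ℝ (Fin d) → EuclideanSpace ℝ (Fin d) → ℝ}
    (hk : Measurable (Function.uncurry k)) {M : ℝ} (hM : ∀ x y, |k x y| ≤ M)
    (hsym : ∀ x y, k x y = k y x) {T : L2 D →L[ℝ] L2 D} (hT : HasKernel T k)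
    {Ω : Type*} [MeasurableSpace Ω] {ρ : Measure Ω} [SFinite ρ] {W : Ω → ℝ}
    (hW : Integrable W ρ) (hW0 : ∀ᵐ ω ∂ρ, 0 ≤ W ω)
    {θ : EuclideanSpace ℝ (Fin d) → Ω → ℝ} (hθ : Measurable (Function.uncurry θ))
    (h : ∀ x y, x ≠ y → k x y = ∫ ω, W ω * Real.cos (θ x ω - θ y ω) ∂ρ) : T.IsPositive := by
  have := isFiniteMeasure_restrict_of_isBounded hD
  have : Nonempty (Fin d) := ⟨⟨0, hd⟩⟩
  rw [ContinuousLinearMap.isPositive_iff]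
  refine ⟨ContinuousLinearMap.isSelfAdjoint_iff_isSymmetric.1
    (isSelfAdjoint_of_hasKernel hD hk hM hsym hT), fun φ => ?_⟩
  set μ := volume.restrict D with hμ
  have hφ := integrable_L2 hD φ
  have e1 : inner ℝ (T φ) φ =
      ∫ y, ∫ x, (∫ ω, φ y * φ x * (W ω * Real.cos (θ x ω - θ y ω)) ∂ρ) ∂μ ∂μ := by
    rw [L2.inner_def]
    refine integral_congr_ae ?_
    filter_upwards [hT φ] with y hy
    rw [hy, real_inner_eq_re_inner, RCLike.inner_apply]
    simp only [conj_trivial, RCLike.re_to_real]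
    rw [← integral_const_mul]
    refine integral_congr_ae ?_
    have hne : ∀ᵐ x ∂μ, x ≠ y := ae_restrict_of_ae (Measure.ae_ne volume y)
    filter_upwards [hne] with x hx
    rw [integral_const_mul, h x y hx]
    ring
  have hφφ : Integrable (fun p : EuclideanSpace ℝ (Fin d) × EuclideanSpace ℝ (Fin d) =>
      φ p.1 * φ p.2) (μ.prod μ) := hφ.mul_prod hφ
  have hθ1 : Measurable fun p : (EuclideanSpace ℝ (Fin d) × EuclideanSpace ℝ (Fin d)) × Ω =>
      θ p.1.1 p.2 := hθ.comp ((measurable_fst.comp measurable_fst).prodMk measurable_snd)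
  have hθ2 : Measurable fun p : (EuclideanSpace ℝ (Fin d) × EuclideanSpace ℝ (Fin d)) × Ω =>
      θ p.1.2 p.2 := hθ.comp ((measurable_snd.comp measurable_fst).prodMk measurable_snd)
  have hint : Integrable (fun p : (EuclideanSpace ℝ (Fin d) × EuclideanSpace ℝ (Fin d)) × Ω =>
      φ p.1.1 * φ p.1.2 * (W p.2 * Real.cos (θ p.1.2 p.2 - θ p.1.1 p.2)))
      ((μ.prod μ).prod ρ) := by
    have h1 := (hφφ.mul_prod hW).mul_bdd (c := 1)
      (Real.measurable_cos.comp (hθ2.sub hθ1)).aestronglyMeasurable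
      (Eventually.of_forall fun p => by simpa using Real.abs_cos_le_one _)
    refine h1.congr (Eventually.of_forall fun p => ?_)
    simp only [Function.comp_apply, mul_assoc]
    rfl
  have e2 : inner ℝ (T φ) φ = ∫ ω, ∫ p, φ p.1 * φ p.2 *
      (W ω * Real.cos (θ p.2 ω - θ p.1 ω)) ∂(μ.prod μ) ∂ρ := by
    have e := integral_integral_swap (μ := μ.prod μ) (ν := ρ)
      (f := fun (p : EuclideanSpace ℝ (Fin d) × EuclideanSpace ℝ (Fin d)) ω => φ p.1 * φ p.2 *
      (W ω * Real.cos (θ p.2 ω - θ p.1 ω))) hint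
    rw [e1, ← e, integral_prod _ hint.integral_prod_left]
  rw [e2]
  refine integral_nonneg_of_ae ?_
  filter_upwards [hW0] with ω hω
  have hθω : Measurable fun x => θ x ω := hθ.comp (measurable_id.prodMk measurable_const)
  have hc : Integrable (fun x => φ x * Real.cos (θ x ω)) μ :=
    hφ.mul_bdd (c := 1) (Real.measurable_cos.comp hθω).aestronglyMeasurable
      (Eventually.of_forall fun x => by simpa using Real.abs_cos_le_one _)
  have hs : Integrable (fun x => φ x * Real.sin (θ x ω)) μ :=
    hφ.mul_bdd (c := 1) (Real.measurable_sin.comp hθω).aestronglyMeasurable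
      (Eventually.of_forall fun x => by simpa using Real.abs_sin_le_one _)
  -- The addition formula for cos turns the double integral into a sum of two squares.
  have e3 : ∫ p, φ p.1 * φ p.2 * (W ω * Real.cos (θ p.2 ω - θ p.1 ω)) ∂(μ.prod μ) =
      W ω * ((∫ x, φ x * Real.cos (θ x ω) ∂μ) ^ 2 + (∫ x, φ x * Real.sin (θ x ω) ∂μ) ^ 2) := by
    rw [pow_two, pow_two, ← integral_prod_mul, ← integral_prod_mul,
      ← integral_add (hc.mul_prod hc) (hs.mul_prod hs), ← integral_const_mul]
    refine integral_congr_ae (Eventually.of_forall fun p => ?_)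
    simp only [Real.cos_sub]
    ring
  rw [e3]
  exact mul_nonneg hω (by positivity)

theorem integral_cos_inner_stdGaussian (v : EuclideanSpace ℝ (Fin d)) :
    ∫ w, Real.cos (inner ℝ w v) ∂(ProbabilityTheory.stdGaussian (EuclideanSpace ℝ (Fin d))) =
      Real.exp (-‖v‖ ^ 2 / 2) := by
  have h := ProbabilityTheory.charFun_stdGaussian v
  rw [charFun_apply] at h
  have hi : Integrable (fun w : EuclideanSpace ℝ (Fin d) =>
      Complex.exp (inner ℝ w v * Complex.I))
      (ProbabilityTheory.stdGaussian (EuclideanSpace ℝ (Fin d))) := by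
    refine Integrable.of_bound (C := 1) ?_ (Eventually.of_forall fun w => ?_)
    · exact Continuous.aestronglyMeasurable (by fun_prop)
    · rw [Complex.norm_exp_ofReal_mul_I]
  have h2 := congrArg Complex.re h
  have h3 := integral_re hi
  simp only [RCLike.re_to_complex] at h3
  rw [← h3] at h2
  simp only [Complex.exp_ofReal_mul_I_re] at h2
  rw [h2, ← Complex.exp_ofReal_re]
  push_cast
  rfl

/-- In the integral for `H_ν` the factor `exp(-κ |x-y|² / s)` is the expectation of `cos(√(2κ/s) ⟪w,
x - y⟫)` for a standard Gaussian `w`, so the kernel is a nonnegative mixture over `(s, w)`. -/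
theorem maternOperator_isPositive (hd : 1 ≤ d) (hD : Bornology.IsBounded D) {ν ℓ : ℝ} (σ : ℝ)
    (hν : 0 < ν) (hℓ : 0 < ℓ) : (maternOperator D ν ℓ σ).IsPositive := by
  set κ := ν / (2 * ℓ ^ 2) with hκ
  have hκ0 : 0 < κ := by positivity
  set γ := ProbabilityTheory.stdGaussian (EuclideanSpace ℝ (Fin d))
  have hΓ := Real.Gamma_pos_of_pos hν
  have hW1 : Integrable (fun s : ℝ => σ ^ 2 / Real.Gamma ν * (Real.exp (-s) * s ^ (ν - 1)))
      (volume.restrict (Ioi 0)) := (Real.GammaIntegral_convergent hν).const_mul _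
  have hW : Integrable (fun p : ℝ × EuclideanSpace ℝ (Fin d) =>
      σ ^ 2 / Real.Gamma ν * (Real.exp (-p.1) * p.1 ^ (ν - 1)))
      ((volume.restrict (Ioi 0)).prod γ) := hW1.comp_fst γ
  have hθ : Measurable (Function.uncurry fun (x : EuclideanSpace ℝ (Fin d))
      (p : ℝ × EuclideanSpace ℝ (Fin d)) => √(2 * κ / p.1) * inner ℝ p.2 x) := by
    unfold Function.uncurry
    fun_prop
  refine isPositive_of_hasKernel_cos hd hD (k := fun x y => maternKernel ν ℓ σ (dist x y))
    ((measurable_maternKernel ν ℓ σ).comp measurable_dist)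
    (fun x y => abs_maternKernel_le σ hν hℓ dist_nonneg)
    (fun x y => by rw [dist_comm]) (maternOperator_hasKernel hD σ hν hℓ) hW ?_ hθ ?_
  · have h1 : ∀ᵐ s ∂(volume.restrict (Ioi (0 : ℝ))), (0 : ℝ) < s :=
      ae_restrict_mem measurableSet_Ioi
    filter_upwards [Measure.quasiMeasurePreserving_fst.ae h1] with p hp
    positivity
  · intro x y hxy
    have hz : 0 < dist x y := dist_pos.2 hxy
    have hint : Integrable (fun p : ℝ × EuclideanSpace ℝ (Fin d) =>
        σ ^ 2 / Real.Gamma ν * (Real.exp (-p.1) * p.1 ^ (ν - 1)) *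
          Real.cos (√(2 * κ / p.1) * inner ℝ p.2 x - √(2 * κ / p.1) * inner ℝ p.2 y))
        ((volume.restrict (Ioi 0)).prod γ) := by
      refine hW.mul_bdd (c := 1) ?_ (Eventually.of_forall fun p => by
        simpa using Real.abs_cos_le_one _)
      exact Measurable.aestronglyMeasurable (by fun_prop)
    rw [maternKernel_eq_besselH σ hν hℓ hz, besselH, integral_prod _ hint, ← integral_const_mul]
    refine setIntegral_congr_fun measurableSet_Ioi fun s hs => ?_
    have hs : 0 < s := hs
    simp only
    rw [integral_const_mul]
    have h1 : ∀ w : EuclideanSpace ℝ (Fin d), √(2 * κ / s) * inner ℝ w x -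
        √(2 * κ / s) * inner ℝ w y = inner ℝ w (√(2 * κ / s) • (x - y)) := fun w => by
      rw [inner_smul_right, inner_sub_right, mul_sub]
    simp only [h1]
    rw [integral_cos_inner_stdGaussian, norm_smul, mul_pow, Real.norm_eq_abs, sq_abs,
      Real.sq_sqrt (by positivity), ← dist_eq_norm, sub_eq_add_neg (-s), Real.exp_add]
    have h2 : -(2 * κ / s * dist x y ^ 2) / 2 = -(ν * dist x y ^ 2 / (2 * ℓ ^ 2) / s) := by
      rw [hκ]
      field_simp
    rw [h2]
    ring

end PositiveDefinite

/-! ### Truncated radial kernels and the assembly. -/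

section Matern

variable {d : ℕ} {D : Set (EuclideanSpace ℝ (Fin d))}

/-- The radial kernel `g(|x - y|)`, cut off at distance `δ` so that it is bounded. -/
noncomputable def truncatedRadialKernel (δ : ℝ) (g : ℝ → ℝ) (x y : EuclideanSpace ℝ (Fin d)) : ℝ :=
  g (min (dist x y) δ)

/-- The cut-off confines the argument of `g` to the compact interval `[0, δ]`. With `δ = diam D` it
changes nothing on `D × D`. -/
theorem uniformContinuous_truncatedRadialKernel {δ : ℝ} (hδ : 0 ≤ δ) {g : ℝ → ℝ}
    (hg : Continuous g) :
    UniformContinuous (Function.uncurry (truncatedRadialKernel (d := d) δ g)) := by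
  have h1 : UniformContinuous fun z : Icc 0 δ => g z :=
    CompactSpace.uniformContinuous_of_continuous (hg.comp continuous_subtype_val)
  have h2 : UniformContinuous fun p : EuclideanSpace ℝ (Fin d) × EuclideanSpace ℝ (Fin d) =>
      min (dist p.1 p.2) δ :=
    (LipschitzWith.id.min_const δ).uniformContinuous.comp uniformContinuous_dist
  exact h1.comp (h2.subtype_mk fun p => ⟨le_min dist_nonneg hδ, min_le_right _ _⟩)

theorem exists_abs_truncatedRadialKernel_le {δ : ℝ} (hδ : 0 ≤ δ) {g : ℝ → ℝ}
    (hg : Continuous g) :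
    ∃ M, ∀ x y : EuclideanSpace ℝ (Fin d), |truncatedRadialKernel δ g x y| ≤ M := by
  obtain ⟨M, hM⟩ := (isCompact_Icc (a := (0 : ℝ)) (b := δ)).exists_bound_of_continuousOn
    hg.continuousOn
  exact ⟨M, fun x y => hM _ ⟨le_min dist_nonneg hδ, min_le_right _ _⟩⟩

theorem maternOperator_eq_sq_smul (hDm : MeasurableSet D) (hd : 1 ≤ d)
    (hD : Bornology.IsBounded D) {ν ℓ : ℝ} (σ : ℝ) (hν : 0 < ν) (hℓ : 0 < ℓ) :
    maternOperator D ν ℓ σ = σ ^ 2 • maternOperator D ν ℓ 1 := by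
  have hm : ∀ σ, Measurable (Function.uncurry fun x y : EuclideanSpace ℝ (Fin d) =>
      maternKernel ν ℓ σ (dist x y)) := fun σ =>
    (measurable_maternKernel ν ℓ σ).comp measurable_dist
  have h := norm_sum_smul_sub_le (ι := Unit) hd hDm hD (fun _ => hm 1)
    (M := fun _ => 2 * 1 ^ 2) (fun _ x y => abs_maternKernel_le 1 hν hℓ dist_nonneg)
    (fun _ => maternOperator_hasKernel hD 1 hν hℓ) (hm σ)
    (fun x y => abs_maternKernel_le σ hν hℓ dist_nonneg)
    (maternOperator_hasKernel hD σ hν hℓ) (fun _ => σ ^ 2) (le_refl 0) (fun x _ y _ _ => by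
      simp [← maternKernel_eq_sq_mul ν ℓ σ])
  simp only [Finset.univ_unique, Finset.sum_singleton, zero_mul, norm_le_zero_iff] at h
  exact (sub_eq_zero.1 h).symm

theorem diam_pos_of_isOpen (hd : 1 ≤ d) (hDo : IsOpen D) (hD : Bornology.IsBounded D)
    (hne : D.Nonempty) : 0 < Metric.diam D := by
  have : Nonempty (Fin d) := ⟨⟨0, hd⟩⟩
  refine Metric.diam_pos ?_ hD
  rw [← Set.not_subsingleton_iff]
  intro hs
  have h1 : volume D = 0 := hs.measure_zero volume
  exact (hDo.measure_pos volume hne).ne' h1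

end Matern

theorem mainTheorem1 (ν : ℝ) (hν : 0 < ν) (hνℕ : ∀ n : ℕ, ν ≠ n) :
    ∃ K : ℝ, 0 < K ∧
      ∀ (d : ℕ), 1 ≤ d → d ≤ 3 →
      ∀ D : Set (EuclideanSpace ℝ (Fin d)), IsOpen D → Bornology.IsBounded D → IsConnected D →
      ∀ ℓmin : ℝ, 0 < ℓmin → ∀ N : ℕ, 0 < N → Even N →
      ∀ ζ : ℝ, ζ = Metric.diam D / ℓmin →
      ∃ C₀ : ℝ × ℝ → L2 D →L[ℝ] L2 D,
        IsLinearlySeparable N {τ : ℝ × ℝ | ℓmin ≤ τ.1 ∧ 0 < τ.2} C₀ ∧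
        ∀ ℓ σ : ℝ, ℓmin ≤ ℓ → 0 < σ →
          C₀ (ℓ, σ) ∈ covarianceOperators (L2 D) ∧
          ‖C₀ (ℓ, σ) - maternOperator D ν ℓ σ‖ ≤
            K * σ ^ 2 * volume.real D * (1 + ζ ^ (2 * ν)) * Real.exp (ζ ^ 2 / 4)
              * ((√(2 * ν) * ζ) ^ N / (N.factorial : ℝ)) ∧
          (√(2 * ν) ≤ ζ →
            ‖C₀ (ℓ, σ) - maternOperator D ν ℓ σ‖ ≤
              K * σ ^ 2 * volume.real D * (1 + ζ ^ (2 * ν)) * Real.exp (ζ ^ 2 / 4)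
                * (ζ ^ (2 * N) / (N.factorial : ℝ))) := by
  obtain ⟨K, hK, happrox⟩ := exists_separable_approx_maternKernel hν hνℕ
  refine ⟨3 * K, by positivity, ?_⟩
  rintro d hd - D hDo hD hDc ℓmin hℓmin N hN ⟨m, rfl⟩ ζ rfl
  have hm : 0 < m := by omega
  have hDm := hDo.measurableSet
  obtain ⟨F, G, i₀, hF0, hF1, hG, hFG⟩ := happrox m hm ℓmin hℓmin
  set δ := Metric.diam D with hδdef
  have hδ : 0 < δ := diam_pos_of_isOpen hd hDo hD hDc.nonempty
  have hvol : 0 < volume.real D := by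
    rw [measureReal_def]
    exact ENNReal.toReal_pos (hDo.measure_pos volume hDc.nonempty).ne' hD.measure_lt_top.ne
  set ζ := δ / ℓmin with hζdef
  have hζ : 0 < ζ := by positivity
  rw [← two_mul m]
  set B := K * (1 + ζ ^ (2 * ν)) * Real.exp (ζ ^ 2 / 4) *
    ((√(2 * ν) * ζ) ^ (2 * m) / ((2 * m).factorial : ℝ)) with hB
  have hB0 : 0 < B := by positivity
  set k : Fin m ⊕ Fin m → EuclideanSpace ℝ (Fin d) → EuclideanSpace ℝ (Fin d) → ℝ :=
    fun i => truncatedRadialKernel δ (G i) with hk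
  have hkc : ∀ i, UniformContinuous (Function.uncurry (k i)) := fun i =>
    uniformContinuous_truncatedRadialKernel hδ.le (hG i)
  have hkm : ∀ i, Measurable (Function.uncurry (k i)) := fun i => (hkc i).continuous.measurable
  choose M hM using fun i => exists_abs_truncatedRadialKernel_le (d := d) hδ.le (hG i)
  choose T hT using fun i => exists_hasKernel hD (hkm i) (hM i)
  have hTsa : ∀ i, IsSelfAdjoint (T i) := fun i =>
    isSelfAdjoint_of_hasKernel hD (hkm i) (hM i)
      (fun x y => by simp only [hk, truncatedRadialKernel, dist_comm]) (hT i)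
  have hTap : ∀ i, IsFiniteDimApproximable (T i) := fun i =>
    isFiniteDimApproximable_of_hasKernel hDm hD (hkc i) (hM i) (hT i)
  -- Only `σ = 1` is approximated; `σ²` is put back as a nonnegative scalar, so it enters the
  -- coefficients and not the operators.
  obtain ⟨T', hT'⟩ := exists_separable_positive_approx (R := ℝ) (S := Ici ℓmin)
    (C := fun ℓ => maternOperator D ν ℓ 1) (ε := B * volume.real D) hTsa hTap hF0 hF1
    (fun ℓ hℓ => maternOperator_isPositive hd hD 1 hν (hℓmin.trans_le hℓ)) (by positivity)
    (fun ℓ hℓ => by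
      have hℓ0 : 0 < ℓ := hℓmin.trans_le hℓ
      refine norm_sum_smul_sub_le hd hDm hD hkm hM hT
        (k' := fun x y => maternKernel ν ℓ 1 (dist x y)) ((measurable_maternKernel ν ℓ 1).comp measurable_dist)
        (fun x y => abs_maternKernel_le 1 hν hℓ0 dist_nonneg)
        (maternOperator_hasKernel hD 1 hν hℓ0) (fun i => F i ℓ) hB0.le fun x hx y hy hxy => ?_
      have hle : dist x y ≤ δ := Metric.dist_le_diam_of_mem hD hx hy
      simp only [hk, truncatedRadialKernel, min_eq_left hle]
      exact hFG ℓ δ (dist x y) hℓ (dist_pos.2 hxy) hle)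
  let e : Fin (2 * m) ≃ Fin m ⊕ Fin m := (finCongr (two_mul m)).trans finSumFinEquiv.symm
  have hsep : ∀ τ : ℝ × ℝ, τ.2 ^ 2 • ∑ i, F i τ.1 • T' i =
      ∑ j, (τ.2 ^ 2 * F (e j) τ.1) • T' (e j) := fun τ => by
    rw [e.sum_comp fun i => (τ.2 ^ 2 * F i τ.1) • T' i, Finset.smul_sum]
    simp only [mul_smul]
  refine ⟨fun τ => τ.2 ^ 2 • ∑ i, F i τ.1 • T' i,
    ⟨fun j τ => τ.2 ^ 2 * F (e j) τ.1, fun j => T' (e j), fun τ _ => hsep τ⟩,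
    fun ℓ σ hℓ hσ => ?_⟩
  obtain ⟨hcov, hnorm⟩ := hT' ℓ hℓ
  have hmain : ‖σ ^ 2 • ∑ i, F i ℓ • T' i - maternOperator D ν ℓ σ‖ ≤
      3 * K * σ ^ 2 * volume.real D * (1 + ζ ^ (2 * ν)) * Real.exp (ζ ^ 2 / 4)
        * ((√(2 * ν) * ζ) ^ (2 * m) / ((2 * m).factorial : ℝ)) := by
    rw [maternOperator_eq_sq_smul hDm hd hD σ hν (hℓmin.trans_le hℓ), ← smul_sub, norm_smul,
      Real.norm_of_nonneg (sq_nonneg σ)]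
    calc _ ≤ σ ^ 2 * (3 * (B * volume.real D)) := by gcongr
      _ = _ := by rw [hB]; ring
  refine ⟨smul_mem_covarianceOperators hcov (sq_nonneg σ), hmain, fun hle => hmain.trans ?_⟩
  -- Here `√(2ν) ζ ≤ ζ · ζ`.
  have hpow : (√(2 * ν) * ζ) ^ (2 * m) ≤ ζ ^ (2 * (2 * m)) := by
    rw [pow_mul ζ 2 (2 * m), pow_two ζ]
    gcongr
  gcongr
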